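/- Consider a blockchain protocol (permissioned or proof-of-stake) run by $n$ active validators, with security parameter $\lambda$, in a synchronous network: in each slot honest validators broadcast messages, and a probabilistic polynomial-time (PPT) adversary delivers each of them to all honest validators and clients after at most $\Delta\ge 1$ slots (to a client that joins later, when it joins). The adversary corrupts a set of validators before the execution starts; corrupted validators deviate arbitrarily. For a proof-of-stake protocol only executions without withdrawal requests are considered, so that the active set stays the same. All validators may send messages to a timestamping service, which orders the accepted messages of each slot and shows the resulting record to everybody from the next slot on; it may reject messages in order to limit the amount of data. At the beginning a PPT environment gives each validator an input of $m$ bits, where $m$ is a polynomial in $\lambda$. Every $m$-bit string is an externally valid input of every validator as long as the chain contains no input of that validator, and an externally valid chain never contains two different inputs of the same validator. Clients output only externally valid chains. Safety is violated if the chains output by two clients, at any two slots, are not prefixes of one another, or if the chain of a client at some slot is not a prefix of its chain at a later slot. $T_{\mathrm{fin}}$-liveness is violated if the input of an honest validator is missing from the chain of some client at a slot $\ge T_{\mathrm{fin}}$. A forensic protocol lets a client that observes a violation compute in polynomial time a proof from its view, the evidence of the violation and transcripts handed over by the validators (honest validators hand over everything they received, corrupted ones anything); every client can check a proof against its own view,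 and thereby identifies a set of validators. The protocol provides $f$-accountable-safety (respectively $f$-$T_{\mathrm{fin}}$-accountable-liveness) if there is a forensic protocol such that, in every execution of polynomial length and except with probability negligible in $\lambda$: (i) whenever safety (respectively $T_{\mathrm{fin}}$-liveness) is violated, the proof makes all clients identify at least $f$ adversarial validators and no honest one; and (ii) no proof produced by the adversary makes a client identify an honest validator. Suppose that any set of up to $F$ validators can be adversarial, where $F\ge n/2$, and that the protocol provides $f_s$-accountable-safety for some $f_s>0$. Suppose further that for all sufficiently large $\lambda$ the number of bits written to the timestamping service is always less than $m\lfloor n/2\rfloor-1$; here the bits of the whole record are counted, in a lossless binary encoding of the accepted messages together with their senders and slots. Then the protocol does not provide $f_a$-$T_{\mathrm{fin}}$-accountable-liveness for any $f_a>0$ and any polynomially bounded $T_{\mathrm{fin}}$. -/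

import Mathlib

namespace Consensus

/-! ### Data and polynomial time -/

/-- Binary trees; every message, state, chain and proof is such a tree. -/
inductive Data : Type
  | nil : Data
  | cons (a b : Data) : Data

namespace Data

def fst : Data → Data
  | nil => nil
  | cons a _ => a

def snd : Data → Data
  | nil => nil
  | cons _ b => b

def size : Data → ℕ
  | nil => 1
  | cons a b => size a + size b + 1

def ofList : List Data → Data
  | [] => nil
  | a :: l => cons a (ofList l)

def toList : Data → List Data
  | nil => []
  | cons a b => a :: toList b

/-- The entry with index `i` of a list, `nil` if there is none. -/
def get : Data → ℕ → Data
  | d, 0 => d.fst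
  | d, i + 1 => d.snd.get i

/-- Unary numbers. -/
def ofNat (k : ℕ) : Data := ofList (List.replicate k nil)

def toNat (d : Data) : ℕ := d.toList.length

def isCons : Data → Bool
  | nil => false
  | cons _ _ => true

def ofBits (s : List Bool) : Data :=
  ofList (s.map fun b => if b then cons nil nil else nil)

def toBits (d : Data) : List Bool := d.toList.map isCons

/-- A table indexed by `Fin n`, as a list. -/
def ofFn {n : ℕ} (f : Fin n → Data) : Data := ofList (List.ofFn f)

/-- Data longer than the bound `b` count as empty. -/
def cut (b : ℕ) (d : Data) : Data := if d.size ≤ b then d else nil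

end Data

/-- Programs of a WHILE language on binary trees. -/
inductive Prog : Type
  | id : Prog
  | nil : Prog
  | fst : Prog
  | snd : Prog
  | cons (p q : Prog) : Prog
  | seq (p q : Prog) : Prog
  | ite (c p q : Prog) : Prog
  | loop (c p : Prog) : Prog

/-- `Runs p x y t`: on input `x` the program `p` halts with output `y` after time `t`.
Copying and projecting cost the size of the data, so the time bounds the size of the output. -/
inductive Runs : Prog → Data → Data → ℕ → Prop
  | id (x : Data) : Runs Prog.id x x x.size
  | nil (x : Data) : Runs Prog.nil x Data.nil 1
  | fst (x : Data) : Runs Prog.fst x x.fst x.size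
  | snd (x : Data) : Runs Prog.snd x x.snd x.size
  | cons {p q : Prog} {x a b : Data} {s t : ℕ} :
      Runs p x a s → Runs q x b t → Runs (Prog.cons p q) x (Data.cons a b) (s + t + 1)
  | seq {p q : Prog} {x y z : Data} {s t : ℕ} :
      Runs p x y s → Runs q y z t → Runs (Prog.seq p q) x z (s + t + 1)
  | ite_true {c p q : Prog} {x a b y : Data} {s t : ℕ} :
      Runs c x (Data.cons a b) s → Runs p x y t → Runs (Prog.ite c p q) x y (s + t + 1)
  | ite_false {c p q : Prog} {x y : Data} {s t : ℕ} :
      Runs c x Data.nil s → Runs q x y t → Runs (Prog.ite c p q) x y (s + t + 1)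
  | loop_stop {c p : Prog} {x : Data} {s : ℕ} :
      Runs c x Data.nil s → Runs (Prog.loop c p) x x (s + x.size + 1)
  | loop_step {c p : Prog} {x a b y z : Data} {s t u : ℕ} :
      Runs c x (Data.cons a b) s → Runs p x y t → Runs (Prog.loop c p) y z u →
      Runs (Prog.loop c p) x z (s + t + u + 1)

/-- `f` is computable in time polynomial in the size of the input. -/
def PolyTime (f : Data → Data) : Prop :=
  ∃ (p : Prog) (q : Polynomial ℕ), ∀ x, ∃ t, Runs p x (f x) t ∧ t ≤ q.eval x.size

/-! ### Negligible functions -/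

/-- Negligible in the security parameter: smaller than every inverse polynomial, eventually. -/
def Negligible (g : ℕ → ℝ) : Prop :=
  Asymptotics.SuperpolynomialDecay Filter.atTop (fun k : ℕ => (k : ℝ)) g

/-! ### Timestamping service -/

/-- What the service has output so far: slot, sender and message of every entry, in order. -/
abbrev Record (n : ℕ) : Type := List (ℕ × Fin n × Data)

/-- The record before slot `r` if the validators submit `subs s` in slot `s`. In each slot the
service takes the submitted messages of the validators listed by its rule `accept`, in that
order, and rejects the others. -/
def recordOf {n : ℕ} (accept : ℕ → Record n → (Fin n → Data) → List (Fin n))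
    (subs : ℕ → Fin n → Data) : ℕ → Record n
  | 0 => []
  | r + 1 =>
    let R := recordOf accept subs r
    R ++ (accept r R (subs r)).map fun v => (r, v, subs r v)

/-- A timestamping service: a rule that orders (and, where it limits the amount of data, rejects)
the messages of each slot, and the lossless binary form in which the record is written. -/
structure Service (n : ℕ) where
  accept : ℕ → Record n → (Fin n → Data) → List (Fin n)
  accept_nodup : ∀ r R sub, (accept r R sub).Nodup
  encode : Record n → List Bool
  encode_injOn : Set.InjOn encode {R | ∃ subs r, recordOf accept subs r = R}

def Service.record {n : ℕ} (I : Service n) (subs : ℕ → Fin n → Data) (r : ℕ) : Record n :=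
  recordOf I.accept subs r

def Record.toData {n : ℕ} (R : Record n) : Data :=
  Data.ofList (R.map fun e =>
    Data.ofList [Data.ofNat e.1, Data.ofNat e.2.1.val, e.2.2])

/-! ### Blockchain protocols -/

/-- The transaction that validator `v` issues with content `s`. -/
def inputTx {n : ℕ} (v : Fin n) (s : List Bool) : Data :=
  Data.cons (Data.ofNat v.val) (Data.ofBits s)

/-- The transactions of a chain; a block is a header together with a list of transactions. -/
def txsOf (chain : List Data) : List Data := chain.flatMap fun B => B.snd.toList

/-- Every transaction of the list is valid with respect to the transactions before it. -/
def ValidTxs (valid : List Data → Data → Prop) (l : List Data) : Prop :=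
  ∀ pre tx post, l = pre ++ tx :: post → valid pre tx

/-- A blockchain protocol run by `n` active validators, with trusted setup (keys and private
coins). Here the active set does not change: this is a permissioned protocol, or a proof-of-stake
protocol on the executions in which no validator asks to withdraw. The security notions below only
ask for something on these executions.
`next` maps `[1^k, pub, v, priv v, input v, transcript]` to the message that validator `v`
broadcasts and the message that it sends to the timestamping service;
`client` maps `[1^k, pub, view]` to the chain that a client with this view outputs. -/
structure Protocol (n : ℕ) where
  setup : ℕ → PMF (Data × (Fin n → Data))
  setup_bound : ∃ q : Polynomial ℕ, ∀ k, ∀ s ∈ (setup k).support,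
    s.1.size ≤ q.eval k ∧ ∀ v, (s.2 v).size ≤ q.eval k
  next : Data → Data
  next_polyTime : PolyTime next
  /-- longer messages are ignored; evaluated at security parameter plus slot -/
  msgBound : Polynomial ℕ
  client : Data → Data
  client_polyTime : PolyTime client
  /-- external validity of a transaction with respect to a prefix -/
  valid : ℕ → List Data → Data → Prop
  client_valid : ∀ k pub view, ValidTxs (valid k)
    (txsOf (client (Data.ofList [Data.ofNat k, pub, view])).toList)

/-- A protocol with a timestamping service in a network with delay bound `Δ`, where each
validator is given an input of `m` bits. -/
structure System (n : ℕ) where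
  protocol : Protocol n
  service : ℕ → Service n
  Δ : ℕ
  Δ_pos : 0 < Δ
  m : Polynomial ℕ

/-- Each string of `m` bits is an externally valid input of each validator as long as no input of
this validator is in the chain, and a valid chain has no two different inputs of a validator. -/
def System.InputsValid {n : ℕ} (S : System n) : Prop :=
  ∀ (k : ℕ) (pre : List Data) (v : Fin n) (s : List Bool),
    ValidTxs (S.protocol.valid k) pre → s.length = S.m.eval k →
    ((∀ s' : List Bool, s'.length = S.m.eval k → inputTx v s' ∉ pre) →
      S.protocol.valid k pre (inputTx v s)) ∧
    (S.protocol.valid k pre (inputTx v s) →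
      ∀ s' : List Bool, s'.length = S.m.eval k → inputTx v s' ∈ pre → s' = s)

/-- The record of the service always has fewer than `m ⌊n/2⌋ - 1` bits. -/
def System.DataLimited {n : ℕ} (S : System n) : Prop :=
  ∀ᶠ k in Filter.atTop, ∀ (subs : ℕ → Fin n → Data) (r : ℕ),
    (((S.service k).encode ((S.service k).record subs r)).length : ℤ) <
      ((S.m.eval k : ℕ) : ℤ) * ((n / 2 : ℕ) : ℤ) - 1

/-! ### Environment and adversary -/

/-- A probabilistic polynomial-time environment: from `[1^k, coins]` it computes the inputs. -/
structure Environment where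
  tapeLen : Polynomial ℕ
  sample : Data → Data
  sample_polyTime : PolyTime sample

/-- The input of validator `v`: the `v`-th string of `m` bits in the output. -/
def Environment.input (Z : Environment) (m k : ℕ) (tape : List Bool) (v : ℕ) : List Bool :=
  List.ofFn fun j : Fin m =>
    (Z.sample (Data.ofList [Data.ofNat k, Data.ofBits tape])).toBits.getD (v * m + j.val) false

/-- A probabilistic polynomial-time adversary, with static corruption. It also fixes the number
of clients and the slots at which they join. Its step function is evaluated once per slot; outputs
(among them its state) longer than `bound`, at security parameter plus slot, count as empty. -/
structure Adversary (n : ℕ) where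
  corrupted : Finset (Fin n)
  clients : ℕ
  join : ℕ → Fin clients → ℕ
  tapeLen : Polynomial ℕ
  bound : Polynomial ℕ
  step : Data → Data
  step_polyTime : PolyTime step

/-- The outcome of all random choices. -/
structure Outcome (n : ℕ) where
  pub : Data
  priv : Fin n → Data
  input : Fin n → List Bool
  tape : List Bool

/-- Setup, coins of the environment and coins of the adversary are independent. -/
noncomputable def System.outcome {n : ℕ} (S : System n) (Z : Environment) (A : Adversary n)
    (k : ℕ) : PMF (Outcome n) :=
  (S.protocol.setup k).bind fun s =>
    (PMF.uniformOfFintype (Fin (Z.tapeLen.eval k) → Bool)).bind fun z =>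
      (PMF.uniformOfFintype (Fin (A.tapeLen.eval k) → Bool)).map fun a =>
        ⟨s.1, s.2, fun v => Z.input (S.m.eval k) k (List.ofFn z) v.val, List.ofFn a⟩

noncomputable def System.prob {n : ℕ} (S : System n) (Z : Environment) (A : Adversary n)
    (k : ℕ) (E : Set (Outcome n)) : ℝ :=
  ((S.outcome Z A k).toOuterMeasure E).toReal

/-! ### Executions -/

/-- Those who receive messages: validators and clients. -/
abbrev Party {n : ℕ} (A : Adversary n) : Type := Fin n ⊕ Fin A.clients

/-- The entry of a party in a pair of tables, one for the validators and one for the clients. -/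
def partyGet {n : ℕ} {A : Adversary n} (dv dc : Data) : Party A → Data
  | Sum.inl v => dv.get v.val
  | Sum.inr c => dc.get c.val

def joinSlot {n : ℕ} (A : Adversary n) (k : ℕ) : Party A → ℕ
  | Sum.inl _ => 0
  | Sum.inr c => A.join k c

/-- The configuration in a slot, after the messages due in this slot have been delivered. -/
structure Conf {n : ℕ} (A : Adversary n) where
  state : Data
  record : Record n
  /-- the messages of each sender that arrive at a party in a slot, as far as already sent -/
  net : ℕ → Party A → Fin n → List Data
  /-- per party, the messages and the record observed in each slot, latest slot first; for a
  validator this is its transcript -/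
  view : Party A → Data

/-- The messages that arrive at a party in a slot, as a table indexed by the senders. -/
def inboxData {n : ℕ} (inbox : Fin n → List Data) : Data :=
  Data.ofFn fun u => Data.ofList (inbox u)

section Execution

variable {n : ℕ} (S : System n) (A : Adversary n) (k : ℕ) (ω : Outcome n)

/-- Output of the algorithm of validator `v` in the given configuration. -/
def validatorOut (C : Conf A) (v : Fin n) : Data :=
  S.protocol.next (Data.ofList
    [Data.ofNat k, ω.pub, Data.ofNat v.val, ω.priv v, Data.ofBits (ω.input v),
      C.view (Sum.inl v)])

/-- The broadcast of `v` in slot `r`, if `v` is honest. -/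
def broadcast (r : ℕ) (C : Conf A) (v : Fin n) : Data :=
  if v ∈ A.corrupted then Data.nil
  else (validatorOut S A k ω C v).fst.cut (S.protocol.msgBound.eval (k + r))

/-- The message of `v` to the service in slot `r`, if `v` is honest. -/
def submission (r : ℕ) (C : Conf A) (v : Fin n) : Data :=
  if v ∈ A.corrupted then Data.nil
  else (validatorOut S A k ω C v).snd.cut (S.protocol.msgBound.eval (k + r))

/-- What the adversary knows from the start: public data, its coins, and the private data and
the inputs of the corrupted validators. -/
def advInfo : Data :=
  Data.ofList [Data.ofNat k, ω.pub, Data.ofBits ω.tape,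
    Data.ofFn fun v => if v ∈ A.corrupted then
      Data.cons (ω.priv v) (Data.ofBits (ω.input v)) else Data.nil]

/-- Output of the adversary in slot `r`. It sees all messages that arrive in this slot, the
record, and the messages that the honest validators send in this slot. The output is a list:
new state; messages of the corrupted validators to the service; messages of the corrupted
validators to the validators and to the clients; delays of the messages of the honest validators
to the validators and to the clients; the transcripts that the corrupted validators hand out if
asked in this slot; a proof of guilt that is shown to all clients. -/
def advOut (r : ℕ) (C : Conf A) : Data :=
  (A.step (Data.ofList
    [advInfo A k ω, C.state,
      Data.ofFn fun v => inboxData (C.net r (Sum.inl v)),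
      Data.ofFn fun c => inboxData (C.net r (Sum.inr c)),
      C.record.toData,
      Data.ofFn (broadcast S A k ω r C),
      Data.ofFn (submission S A k ω r C)])).cut (A.bound.eval (k + r))

/-- Everything submitted to the service in slot `r`. -/
def submissions (r : ℕ) (C : Conf A) (v : Fin n) : Data :=
  if v ∈ A.corrupted then
    (((advOut S A k ω r C).get 1).get v.val).cut (S.protocol.msgBound.eval (k + r))
  else submission S A k ω r C v

/-- The messages of `u` sent in slot `r` to party `w`. -/
def sent (r : ℕ) (C : Conf A) (w : Party A) (u : Fin n) : List Data :=
  if u ∈ A.corrupted then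
    ((partyGet ((advOut S A k ω r C).get 2) ((advOut S A k ω r C).get 3) w).get u.val).toList.map
      (Data.cut (S.protocol.msgBound.eval (k + r)))
  else [broadcast S A k ω r C u]

/-- The slot in which the messages of `u` sent in slot `r` reach party `w`. For honest `u` the
adversary chooses a delay between `1` and `Δ`. Clients that join later get them when they join. -/
def arrival (r : ℕ) (C : Conf A) (w : Party A) (u : Fin n) : ℕ :=
  max (joinSlot A k w)
    (if u ∈ A.corrupted then r + 1
    else r + max 1 (min S.Δ
      ((partyGet ((advOut S A k ω r C).get 4) ((advOut S A k ω r C).get 5) w).get u.val).toNat))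

/-- The configuration in slot `r`. -/
def conf : ℕ → Conf A
  | 0 =>
    { state := Data.nil
      record := []
      net := fun _ _ _ => []
      view := fun _ =>
        Data.ofList [Data.cons (inboxData fun _ : Fin n => []) (Record.toData ([] : Record n))] }
  | r + 1 =>
    let C := conf r
    let R : Record n := C.record ++
      ((S.service k).accept r C.record (submissions S A k ω r C)).map
        fun v => (r, v, submissions S A k ω r C v)
    let net : ℕ → Party A → Fin n → List Data := fun t w u =>
      if t = arrival S A k ω r C w u then C.net t w u ++ sent S A k ω r C w u else C.net t w u
    { state := (advOut S A k ω r C).get 0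
      record := R
      net := net
      view := fun w => Data.cons (Data.cons (inboxData (net (r + 1) w)) R.toData) (C.view w) }

/-- The view of client `c` in slot `r`. -/
def clientView (r : ℕ) (c : Fin A.clients) : Data := (conf S A k ω r).view (Sum.inr c)

/-- The output of client `c` in slot `r`, as data and as a list of blocks. -/
def chainData (r : ℕ) (c : Fin A.clients) : Data :=
  S.protocol.client (Data.ofList [Data.ofNat k, ω.pub, clientView S A k ω r c])

def chain (r : ℕ) (c : Fin A.clients) : List Data := (chainData S A k ω r c).toList

/-- The transcripts that a client gets from the validators in slot `r`. -/
def transcript (r : ℕ) (v : Fin n) : Data :=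
  if v ∈ A.corrupted then ((advOut S A k ω r (conf S A k ω r)).get 6).get v.val
  else (conf S A k ω r).view (Sum.inl v)

/-- The proof of guilt that the adversary shows to the clients in slot `r`. -/
def advProof (r : ℕ) : Data := (advOut S A k ω r (conf S A k ω r)).get 7

end Execution

/-! ### Accountability -/

/-- A forensic protocol. `prove` maps `[1^k, pub, view of the client, evidence of the violation,
transcripts]` to a proof; `verify k pub view π` is the set of validators that a client with the
given view identifies as protocol violators on the proof `π`; the proofs of the clients reach the
other clients after `delay k` slots. -/
structure Forensics (n : ℕ) where
  prove : Data → Data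
  prove_polyTime : PolyTime prove
  verify : ℕ → Data → Data → Data → Finset (Fin n)
  delay : Polynomial ℕ

section Accountability

variable {n : ℕ} (S : System n) (Φ : Forensics n) (A : Adversary n) (k : ℕ) (ω : Outcome n)

/-- The validators that client `c` identifies in slot `r` on the proof `π`. -/
def identified (r : ℕ) (c : Fin A.clients) (π : Data) : Finset (Fin n) :=
  Φ.verify k ω.pub (clientView S A k ω r c) π

/-- The proof of client `c`, which invokes the forensic protocol in slot `r`. -/
def clientProof (r : ℕ) (c : Fin A.clients) (evidence : Data) : Data :=
  Φ.prove (Data.ofList [Data.ofNat k, ω.pub, clientView S A k ω r c, evidence,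
    Data.ofFn (transcript S A k ω r)])

/-- The proof of client `c` from slot `r` makes all clients identify at least `f` adversarial
validators and no honest one. -/
def Accounts (f r : ℕ) (c : Fin A.clients) (evidence : Data) : Prop :=
  ∀ c' : Fin A.clients, A.join k c' ≤ r + Φ.delay.eval k →
    let G := identified S Φ A k ω (r + Φ.delay.eval k) c' (clientProof S Φ A k ω r c evidence)
    f ≤ (G ∩ A.corrupted).card ∧ G ⊆ A.corrupted

/-- Some client identifies, by slot `h`, an honest validator on a proof shown by the adversary. -/
def Framed (h : ℕ) : Prop :=
  ∃ (c : Fin A.clients) (s r : ℕ), s ≤ r ∧ r ≤ h ∧ A.join k c ≤ r ∧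
    ¬ identified S Φ A k ω r c (advProof S A k ω s) ⊆ A.corrupted

/-- The chains of clients `c` in slot `r` and `c'` in slot `r'` violate safety. -/
def SafetyViolation (c c' : Fin A.clients) (r r' : ℕ) : Prop :=
  A.join k c ≤ r ∧ A.join k c' ≤ r' ∧
    ((¬ chain S A k ω r c <+: chain S A k ω r' c' ∧
        ¬ chain S A k ω r' c' <+: chain S A k ω r c) ∨
      (c = c' ∧ r ≤ r' ∧ ¬ chain S A k ω r c <+: chain S A k ω r' c'))

/-- A safety violation by slot `h` on which client `c`, or `c'`, fails to account. -/
def UnaccountedSafetyViolation (f h : ℕ) : Prop :=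
  ∃ (c c' : Fin A.clients) (r r' : ℕ), r ≤ h ∧ r' ≤ h ∧ SafetyViolation S A k ω c c' r r' ∧
    ¬ (Accounts S Φ A k ω f (max r r') c
        (Data.cons (chainData S A k ω r c) (chainData S A k ω r' c')) ∧
      Accounts S Φ A k ω f (max r r') c'
        (Data.cons (chainData S A k ω r c) (chainData S A k ω r' c')))

/-- The input that honest `v` got in slot `0` is not in the chain of `c` in slot `r ≥ T`. -/
def LivenessViolation (T : ℕ) (v : Fin n) (c : Fin A.clients) (r : ℕ) : Prop :=
  v ∉ A.corrupted ∧ A.join k c ≤ r ∧ T ≤ r ∧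
    inputTx v (ω.input v) ∉ txsOf (chain S A k ω r c)

/-- A liveness violation by slot `h` on which the client that observes it fails to account. -/
def UnaccountedLivenessViolation (T f h : ℕ) : Prop :=
  ∃ (v : Fin n) (c : Fin A.clients) (r : ℕ), r ≤ h ∧ LivenessViolation S A k ω T v c r ∧
    ¬ Accounts S Φ A k ω f r c (inputTx v (ω.input v))

end Accountability

/-- `f`-accountable-safety when up to `F` validators can be adversarial. -/
def System.AccountableSafety {n : ℕ} (S : System n) (F f : ℕ) : Prop :=
  ∃ Φ : Forensics n, ∀ (Z : Environment) (A : Adversary n), A.corrupted.card ≤ F →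
    ∀ h : Polynomial ℕ, Negligible fun k => S.prob Z A k
      {ω | UnaccountedSafetyViolation S Φ A k ω f (h.eval k) ∨ Framed S Φ A k ω (h.eval k)}

/-- `f`-`T`-accountable-liveness when up to `F` validators can be adversarial. -/
def System.AccountableLiveness {n : ℕ} (S : System n) (F f : ℕ) (T : ℕ → ℕ) : Prop :=
  ∃ Φ : Forensics n, ∀ (Z : Environment) (A : Adversary n), A.corrupted.card ≤ F →
    ∀ h : Polynomial ℕ, Negligible fun k => S.prob Z A k
      {ω | UnaccountedLivenessViolation S Φ A k ω (T k) f (h.eval k) ∨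
        Framed S Φ A k ω (h.eval k)}

end Consensus

/-! Divide the validators into two sides of sizes `⌊n/2⌋` and `⌈n/2⌉`. Both have at most `F`
members, so either may be corrupted. In a split execution each side runs the protocol by itself and
learns about the other only from the timestamping record. An adversary that corrupts either side can
stage such an execution for a client that hears both sides: its view is the same in both worlds. A
proof that accounts for a violation in one world identifies a validator of the corrupted side; in
the other world that side is honest, and the adversary there can compute the same proof and frame
it. So, up to negligible probability, no violation occurs in either world (`honest_side_consistent`,
`consistent_of_accountable`): the joint chain contains all inputs, the chain of a client that hears
one side contains the inputs of that side, and each of these two chains is comparable with the joint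
chain.

It follows that one of the two side chains contains all inputs. If `x` and `y` are the inputs of the
sides and `ρ x y` is the record, then this record together with `x` determines `y`, or together with
`y` determines `x`. This alone is no contradiction when the sides have equal size, since the record
may favour one side or the other depending on the inputs.

The second ingredient is an adversary that runs its side twice: one copy, with inputs drawn from its
coins, writes to the service, while the clients hear another copy with the true inputs. Suppose `R =
ρ x y' = ρ x' y`. With true inputs `(x, y)`, one world has `y'` submitted instead of `y`, the other
`x'` instead of `x`, and again they look alike. If `R` and `x` decode to `y'`, then the chain of the
first side contains `y'`; it is comparable with the joint chain, which contains `y`, and a valid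
chain has one input per validator. Hence `y' = y` and `R = ρ x y`.

So few triples `(x, y, R)` are decodable from both sides. But at most half as many records exist as
values of `x`, and then nearly every pair being decodable from one side forces many such triples
(`false_of_card_image_le`). All inputs are uniform, so negligible probabilities become small
proportions of input-coin pairs for a suitable fixed setup (`exists_setup_of_prob_lt`), and
`card_inputs_lt_outcomeCount` gives the contradiction. -/

namespace Consensus

/-! ### Polynomials over the natural numbers -/

lemma eval_mono (q : Polynomial ℕ) : Monotone fun x => q.eval x := by
  intro a b hab
  simp only [Polynomial.eval_eq_sum_range]
  gcongr

/-! ### Sizes and entries of trees -/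

namespace Data

@[simp] lemma toList_ofList (l : List Data) : (ofList l).toList = l := by
  induction l with
  | nil => rfl
  | cons a l ih => simp [ofList, toList, ih]

@[simp] lemma toBits_ofBits (l : List Bool) : (ofBits l).toBits = l := by
  rw [ofBits, toBits, toList_ofList, List.map_map]
  conv_rhs => rw [← List.map_id l]
  apply List.map_congr_left
  intro b _
  cases b <;> rfl

lemma size_pos (d : Data) : 0 < d.size := by
  cases d <;> simp [size]

lemma size_cut_le (b : ℕ) (d : Data) : (d.cut b).size ≤ b + 1 := by
  unfold cut
  split_ifs with h
  · omega
  · simp [size]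

lemma cut_of_le {b : ℕ} {d : Data} (h : d.size ≤ b) : d.cut b = d := if_pos h

@[simp] lemma get_nil (i : ℕ) : nil.get i = nil := by
  induction i with
  | zero => rfl
  | succ i ih => simpa [get, snd] using ih

@[simp] lemma get_cons_zero (a b : Data) : (cons a b).get 0 = a := rfl

@[simp] lemma get_cons_succ (a b : Data) (i : ℕ) : (cons a b).get (i + 1) = b.get i := rfl

lemma get_ofList (l : List Data) (i : ℕ) : (ofList l).get i = l.getD i nil := by
  induction l generalizing i with
  | nil => simp [ofList]
  | cons a l ih => cases i with
    | zero => rfl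
    | succ i => simpa [ofList] using ih i

@[simp] lemma get_ofFn {n : ℕ} (f : Fin n → Data) (i : Fin n) : (ofFn f).get i.val = f i := by
  simp [ofFn, get_ofList]

lemma size_ofList_le (l : List Data) (B : ℕ) (h : ∀ a ∈ l, a.size ≤ B) :
    (ofList l).size ≤ l.length * (B + 1) + 1 := by
  induction l with
  | nil => simp [ofList, size]
  | cons a l ih =>
    have h1 := h a (by simp)
    have h2 := ih fun b hb => h b (by simp [hb])
    simp only [ofList, size, List.length_cons]
    nlinarith

lemma size_ofFn_le {n : ℕ} (f : Fin n → Data) (B : ℕ) (h : ∀ i, (f i).size ≤ B) :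
    (ofFn f).size ≤ n * (B + 1) + 1 := by
  have := size_ofList_le (List.ofFn f) B (by simpa [List.mem_ofFn] using h)
  simpa [ofFn] using this

lemma size_ofNat (k : ℕ) : (ofNat k).size ≤ 2 * k + 1 := by
  have := size_ofList_le (List.replicate k nil) 1 (by
    intro a ha
    rw [List.eq_of_mem_replicate ha]
    simp [size])
  simp only [List.length_replicate] at this
  unfold ofNat
  omega

lemma size_ofBits (l : List Bool) : (ofBits l).size ≤ 4 * l.length + 1 := by
  have := size_ofList_le (l.map fun b => if b then cons nil nil else nil) 3 (by
    intro a ha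
    obtain ⟨b, -, rfl⟩ := List.mem_map.1 ha
    cases b <;> simp [size])
  simp only [List.length_map] at this
  unfold ofBits
  omega

lemma size_snd_le (d : Data) : d.snd.size ≤ d.size := by
  cases d <;> simp only [snd, size] <;> omega

lemma size_fst_le (d : Data) : d.fst.size ≤ d.size := by
  cases d <;> simp only [fst, size] <;> omega

lemma size_iterate_snd_le (d : Data) (i : ℕ) : (snd^[i] d).size ≤ d.size := by
  induction i generalizing d with
  | zero => rfl
  | succ i ih => exact (ih _).trans (size_snd_le d)

/-- The entry with index `i < j` lies in the part of the list that `snd^[j]` drops. The extra unit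
is for the empty list, where both terms are `nil`. -/
lemma size_get_add_size_iterate_snd_le (d : Data) {i j : ℕ} (h : i < j) :
    (d.get i).size + (snd^[j] d).size ≤ d.size + 1 := by
  induction i generalizing d j with
  | zero =>
    obtain ⟨j, rfl⟩ : ∃ j', j = j' + 1 := ⟨j - 1, by omega⟩
    have := size_iterate_snd_le d.snd j
    cases d with
    | nil =>
      simp only [get, fst, snd, Function.iterate_succ_apply, size] at this ⊢
      omega
    | cons a b =>
      simp only [snd] at this
      simp only [get, fst, Function.iterate_succ_apply, size, snd]
      omega
  | succ i ih =>
    obtain ⟨j, rfl⟩ : ∃ j', j = j' + 1 := ⟨j - 1, by omega⟩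
    have h1 := ih d.snd (j := j) (by omega)
    have h2 := size_snd_le d
    simp only [get, Function.iterate_succ_apply]
    omega

lemma size_iterate_snd_lt {d : Data} (hd : d ≠ nil) {j : ℕ} (hj : 0 < j) :
    (snd^[j] d).size < d.size := by
  obtain ⟨j, rfl⟩ : ∃ j', j = j' + 1 := ⟨j - 1, by omega⟩
  have := size_iterate_snd_le d.snd j
  cases d with
  | nil => exact absurd rfl hd
  | cons a b =>
    simp only [snd] at this
    simp only [Function.iterate_succ_apply, size, snd]
    omega

end Data

/-! ### Closure properties of polynomial time -/

/-- Copying and projecting are charged by size. Polynomial running time therefore bounds outputs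
polynomially, as is needed for composition and for the output bound of the adversary. -/
lemma Runs.size_le {p : Prog} {x y : Data} {t : ℕ} (h : Runs p x y t) : y.size ≤ t := by
  induction h with
  | id x => exact le_rfl
  | nil x => simp [Data.size]
  | fst x => exact x.size_fst_le
  | snd x => exact x.size_snd_le
  | cons _ _ h1 h2 => simp only [Data.size]; omega
  | seq _ _ h1 h2 => omega
  | ite_true _ _ h1 h2 => omega
  | ite_false _ _ h1 h2 => omega
  | loop_stop _ h1 => omega
  | loop_step _ _ _ h1 h2 h3 => omega

lemma PolyTime.exists_size_le {f : Data → Data} (hf : PolyTime f) :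
    ∃ q : Polynomial ℕ, ∀ x, (f x).size ≤ q.eval x.size := by
  obtain ⟨p, q, h⟩ := hf
  refine ⟨q, fun x => ?_⟩
  obtain ⟨t, h1, h2⟩ := h x
  exact h1.size_le.trans h2

lemma PolyTime.id : PolyTime fun x => x :=
  ⟨Prog.id, Polynomial.X, fun x => ⟨_, Runs.id x, by simp⟩⟩

lemma PolyTime.nil : PolyTime fun _ => Data.nil :=
  ⟨Prog.nil, 1, fun x => ⟨_, Runs.nil x, by simp⟩⟩

lemma PolyTime.comp {f g : Data → Data} (hg : PolyTime g) (hf : PolyTime f) :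
    PolyTime fun x => g (f x) := by
  obtain ⟨p, q, h⟩ := hf
  obtain ⟨p', q', h'⟩ := hg
  refine ⟨Prog.seq p p', q + q'.comp q + 1, fun x => ?_⟩
  obtain ⟨t, h1, h2⟩ := h x
  obtain ⟨t', h1', h2'⟩ := h' (f x)
  refine ⟨_, Runs.seq h1 h1', ?_⟩
  have := eval_mono q' (h1.size_le.trans h2)
  simp only [Polynomial.eval_add, Polynomial.eval_comp, Polynomial.eval_one]
  simp only at this
  omega

lemma PolyTime.cons {f g : Data → Data} (hf : PolyTime f) (hg : PolyTime g) :
    PolyTime fun x => Data.cons (f x) (g x) := by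
  obtain ⟨p, q, h⟩ := hf
  obtain ⟨p', q', h'⟩ := hg
  refine ⟨Prog.cons p p', q + q' + 1, fun x => ?_⟩
  obtain ⟨t, h1, h2⟩ := h x
  obtain ⟨t', h1', h2'⟩ := h' x
  refine ⟨_, Runs.cons h1 h1', ?_⟩
  simp only [Polynomial.eval_add, Polynomial.eval_one]
  omega

lemma PolyTime.fst {f : Data → Data} (hf : PolyTime f) : PolyTime fun x => (f x).fst :=
  PolyTime.comp (g := Data.fst) ⟨Prog.fst, Polynomial.X, fun x => ⟨_, Runs.fst x, by simp⟩⟩ hf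

lemma PolyTime.snd {f : Data → Data} (hf : PolyTime f) : PolyTime fun x => (f x).snd :=
  PolyTime.comp (g := Data.snd) ⟨Prog.snd, Polynomial.X, fun x => ⟨_, Runs.snd x, by simp⟩⟩ hf

lemma PolyTime.const (d : Data) : PolyTime fun _ => d := by
  induction d with
  | nil => exact PolyTime.nil
  | cons a b ha hb => exact ha.cons hb

lemma PolyTime.get {f : Data → Data} (hf : PolyTime f) (i : ℕ) :
    PolyTime fun x => (f x).get i := by
  induction i generalizing f with
  | zero => exact hf.fst
  | succ i ih => exact ih hf.snd

lemma PolyTime.iterate_snd {f : Data → Data} (hf : PolyTime f) (i : ℕ) :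
    PolyTime fun x => Data.snd^[i] (f x) := by
  induction i generalizing f with
  | zero => exact hf
  | succ i ih => exact ih hf.snd

lemma PolyTime.ofFn {n : ℕ} {f : Fin n → Data → Data} (hf : ∀ i, PolyTime (f i)) :
    PolyTime fun x => Data.ofFn fun i => f i x := by
  induction n with
  | zero => exact PolyTime.nil
  | succ n ih =>
    have := (hf 0).cons (ih fun i => hf i.succ)
    simpa only [Data.ofFn, List.ofFn_succ, Data.ofList] using this

lemma PolyTime.ofList_nil : PolyTime fun _ => Data.ofList [] := PolyTime.nil

lemma PolyTime.ofList_cons {f : Data → Data} {g : Data → List Data} (hf : PolyTime f)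
    (hg : PolyTime fun x => Data.ofList (g x)) :
    PolyTime fun x => Data.ofList (f x :: g x) := hf.cons hg

/-- The condition does not depend on the input, so the choice is between two programs and needs no
branching. -/
lemma PolyTime.ite {p : Prop} [Decidable p] {f g : Data → Data} (hf : PolyTime f)
    (hg : PolyTime g) : PolyTime fun x => if p then f x else g x := by
  by_cases h : p <;> simpa [h]

/-- A loop that runs while the first component is nonempty. -/
lemma PolyTime.loop {g L : Data → Data} (hg : PolyTime g) (C : ℕ)
    (hsize : ∀ x, (g x).size ≤ x.size + C)
    (hdec : ∀ x, x.fst ≠ Data.nil → (g x).fst.size < x.fst.size)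
    (hhalt : ∀ x, x.fst = Data.nil → L x = x)
    (hstep : ∀ x, x.fst ≠ Data.nil → L x = L (g x)) : PolyTime L := by
  obtain ⟨p, q, hp⟩ := hg
  -- The first component shrinks in every pass, so `j` bounds the remaining passes. With growth at
  -- most `C` per pass all sizes stay below `B`, and a pass costs at most `q(B) + 2B + 1`.
  have key : ∀ (B j : ℕ) (x : Data), x.fst.size ≤ j → x.size + j * C ≤ B →
      ∃ t, Runs (Prog.loop Prog.fst p) x (L x) t ∧ t ≤ (j + 1) * (q.eval B + 2 * B + 1) := by
    intro B j
    induction j with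
    | zero => intro x hx; exact absurd x.fst.size_pos (by omega)
    | succ j ih =>
      intro x hx hB
      rcases hfst : x.fst with _ | ⟨a, b⟩
      · refine ⟨_, by rw [hhalt x hfst]; exact Runs.loop_stop (hfst ▸ Runs.fst x), ?_⟩
        have : x.size ≤ B := by omega
        nlinarith [Nat.zero_le (q.eval B)]
      · have hne : x.fst ≠ Data.nil := by simp [hfst]
        obtain ⟨t, h1, h2⟩ := hp x
        have h3 := hsize x
        obtain ⟨u, h4, h5⟩ := ih (g x) (by have := hdec x hne; omega) (by
          have : (j + 1) * C = j * C + C := by ring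
          omega)
        refine ⟨_, by rw [hstep x hne]; exact Runs.loop_step (hfst ▸ Runs.fst x) h1 h4, ?_⟩
        have hx : x.size ≤ B := le_trans (Nat.le_add_right _ _) hB
        have := eval_mono q hx
        simp only at this
        have e : (j + 1 + 1) * (q.eval B + 2 * B + 1) =
          (j + 1) * (q.eval B + 2 * B + 1) + (q.eval B + 2 * B + 1) := by ring
        omega
  let B : Polynomial ℕ := Polynomial.X + Polynomial.X * Polynomial.C C
  refine ⟨Prog.loop Prog.fst p, (Polynomial.X + 1) * (q.comp B + 2 * B + 1), fun x => ?_⟩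
  obtain ⟨t, h1, h2⟩ := key (x.size + x.size * C) x.size x x.size_fst_le le_rfl
  refine ⟨t, h1, h2.trans_eq ?_⟩
  simp [B]

/-! ### Extracting every `n`-th bit -/

/-- One step of the extraction of the entries of a list with indices `i`, `i + n`, `i + 2n`, ... -/
def sliceStep (n i : ℕ) (d : Data) : Data :=
  Data.cons (Data.snd^[n] d.fst) (Data.cons (d.fst.get i) d.snd)

lemma sliceStep_fst_size_lt {n : ℕ} (hn : 0 < n) (i : ℕ) {d : Data} (h : d.fst ≠ Data.nil) :
    (sliceStep n i d).fst.size < d.fst.size :=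
  Data.size_iterate_snd_lt h hn

lemma Data.isCons_iff {d : Data} : d.isCons = true ↔ d ≠ Data.nil := by
  cases d <;> simp [Data.isCons]

/-- The stride `n` is constant, so a fixed number of projections skips a row. Cutting the coins into
blocks of length `m(k)` would require a counter; this is why they are interleaved. The test `0 < n`
serves only termination. -/
def sliceLoop (n i : ℕ) (d : Data) : Data :=
  if _ : 0 < n ∧ d.fst.isCons = true then sliceLoop n i (sliceStep n i d) else d
termination_by d.fst.size
decreasing_by rename_i h; exact sliceStep_fst_size_lt h.1 i (Data.isCons_iff.1 h.2)

lemma sliceLoop_of_nil {n i : ℕ} {d : Data} (h : d.fst = Data.nil) : sliceLoop n i d = d := by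
  rw [sliceLoop, dif_neg]
  simp [h, Data.isCons]

lemma sliceLoop_of_ne_nil {n : ℕ} (hn : 0 < n) (i : ℕ) {d : Data} (h : d.fst ≠ Data.nil) :
    sliceLoop n i d = sliceLoop n i (sliceStep n i d) := by
  conv_lhs => rw [sliceLoop, dif_pos ⟨hn, Data.isCons_iff.2 h⟩]

lemma polyTime_sliceLoop {n i : ℕ} (hi : i < n) : PolyTime (sliceLoop n i) := by
  have hn : 0 < n := by omega
  -- The constant `4` counts two new nodes and one unit of slack in each of the two size estimates
  -- below, due to `nil` being its own child.
  refine PolyTime.loop (g := sliceStep n i) ?_ 4 (fun x => ?_)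
    (fun x => sliceStep_fst_size_lt hn i) (fun x => sliceLoop_of_nil)
    (fun x => sliceLoop_of_ne_nil hn i)
  · exact (PolyTime.id.fst.iterate_snd n).cons ((PolyTime.id.fst.get i).cons PolyTime.id.snd)
  · have h1 := Data.size_get_add_size_iterate_snd_le x.fst hi
    have h2 : x.fst.size + x.snd.size ≤ x.size + 1 := by
      cases x <;> simp only [Data.fst, Data.snd, Data.size] <;> omega
    simp only [sliceStep, Data.size]
    omega

/-- The entries with indices `i`, `i + n`, `i + 2n`, ... of a list, last one first. -/
def slice (n i : ℕ) (d : Data) : Data := (sliceLoop n i (Data.cons d Data.nil)).snd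

lemma polyTime_slice {n i : ℕ} (hi : i < n) : PolyTime (slice n i) :=
  ((polyTime_sliceLoop hi).comp (PolyTime.id.cons PolyTime.nil)).snd

lemma Data.iterate_snd_ofList (l : List Data) (j : ℕ) :
    Data.snd^[j] (Data.ofList l) = Data.ofList (l.drop j) := by
  induction j generalizing l with
  | zero => rfl
  | succ j ih => cases l with
    | nil => simpa [Data.ofList, Data.snd] using ih []
    | cons a l => simpa [Data.ofList, Data.snd] using ih l

lemma sliceLoop_ofList {n i : ℕ} (hi : i < n) (m : ℕ) (f : Fin m → Fin n → Data)
    (l : List Data) :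
    sliceLoop n i (Data.cons (Data.ofList (List.ofFn fun p : Fin (m * n) =>
        f (finProdFinEquiv.symm p).1 (finProdFinEquiv.symm p).2)) (Data.ofList l)) =
      Data.cons Data.nil (Data.ofList ((List.ofFn fun j => f j ⟨i, hi⟩).reverse ++ l)) := by
  have hn : 0 < n := by omega
  -- `finProdFinEquiv` numbers `(j, i)` as `i + n * j`, so the list consists of `m` rows of length
  -- `n`, and each pass removes one row.
  have e : (List.ofFn fun p : Fin (m * n) =>
      f (finProdFinEquiv.symm p).1 (finProdFinEquiv.symm p).2) =
      (List.ofFn fun j => List.ofFn fun i => f j i).flatten := by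
    rw [List.ofFn_mul]
    congr 1
    congr 1
    ext1 j
    congr 1
    ext1 i
    have : (⟨j * n + i, by
        calc j * n + i < (j + 1) * n := by rw [add_mul, one_mul]; omega
          _ ≤ m * n := Nat.mul_le_mul_right n j.2⟩ : Fin (m * n)) = finProdFinEquiv (j, i) := by
      ext
      simp [finProdFinEquiv, mul_comm, add_comm]
    rw [this, Equiv.symm_apply_apply]
  rw [e]
  clear e
  induction m generalizing l with
  | zero => rw [sliceLoop_of_nil rfl]; rfl
  | succ m ih =>
    rw [List.ofFn_succ, List.flatten_cons, sliceLoop_of_ne_nil hn]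
    · simp only [sliceStep, Data.fst, Data.snd, Data.iterate_snd_ofList, Data.get_ofList]
      rw [List.drop_left' (by simp), List.getD_append _ _ _ _ (by simpa using hi)]
      have := ih (fun j => f j.succ) (f 0 ⟨i, hi⟩ :: l)
      simp only [Data.ofList] at this
      rw [show (List.ofFn fun i => f 0 i).getD i Data.nil = f 0 ⟨i, hi⟩ by
        rw [List.getD_eq_getElem _ _ (by simpa using hi)]; simp]
      rw [this]
      simp [List.ofFn_succ]
    · obtain ⟨n, rfl⟩ : ∃ n', n = n' + 1 := ⟨n - 1, by omega⟩
      simp [List.ofFn_succ, Data.ofList, Data.fst]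

lemma slice_ofBits {n : ℕ} (i : Fin n) (m : ℕ) (f : Fin m → Fin n → Bool) :
    slice n i (Data.ofBits (List.ofFn fun p : Fin (m * n) =>
        f (finProdFinEquiv.symm p).1 (finProdFinEquiv.symm p).2)) =
      Data.ofBits (List.ofFn fun j => f j i).reverse := by
  have := sliceLoop_ofList i.2 m
    (fun j i => if f j i then Data.cons Data.nil Data.nil else Data.nil) []
  simp only [Data.ofList, List.append_nil] at this
  rw [slice, Data.ofBits, List.map_ofFn, Function.comp_def, this, Data.snd, Data.ofBits,
    List.map_reverse, List.map_ofFn, Function.comp_def]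

/-! ### Counting -/

open Classical in
/-- Suppose that `ρ` has at most `|X| / 2` values, and that for most pairs `(x, y)` the value
`ρ x y` determines `y` together with `x`, or determines `x` together with `y`. Then there are many
triples `(x, y, R)` such that `R` determines some `y'` with `x` and some `x'` with `y`. This is
impossible if `y' = y` for most of them. -/
lemma false_of_card_image_le {X Y W : Type*} [Fintype X] [Fintype Y] (ρ : X → Y → W)
    (C₁ : X → W → Y → Prop) (C₂ : Y → W → X → Prop)
    (hC₁ : ∀ x R y y', C₁ x R y → C₁ x R y' → y = y')
    (hC₂ : ∀ y R x x', C₂ y R x → C₂ y R x' → x = x')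
    (B₀ : Finset (X × Y)) (B₁ : Finset (X × Y × Y)) (B₂ : Finset (X × Y × X))
    (h₀ : ∀ x y, (x, y) ∉ B₀ → C₁ x (ρ x y) y ∨ C₂ y (ρ x y) x)
    (h₁ : ∀ x y x' y', (x, y, y') ∉ B₁ → (x, y, x') ∉ B₂ → ρ x y' = ρ x' y →
      C₁ x (ρ x y') y' → y' = y)
    (hN : 2 * (Finset.univ.image fun p : X × Y => ρ p.1 p.2).card ≤ Fintype.card X)
    (hX : 3 ≤ Fintype.card X)
    (hXY : Fintype.card X = Fintype.card Y ∨ 2 * Fintype.card X ≤ Fintype.card Y)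
    (hB₀ : 100 * B₀.card ≤ Fintype.card X * Fintype.card Y)
    (hB₁ : 100 * B₁.card ≤ Fintype.card X * Fintype.card Y * Fintype.card Y)
    (hB₂ : 100 * B₂.card ≤ Fintype.card X * Fintype.card Y * Fintype.card X) : False := by
  set 𝓡 := Finset.univ.image fun p : X × Y => ρ p.1 p.2 with h𝓡
  have mem𝓡 : ∀ x y, ρ x y ∈ 𝓡 := fun x y => Finset.mem_image_of_mem _ (Finset.mem_univ (x, y))
  let A : W → Finset X := fun R => Finset.univ.filter fun x => ∃ y', ρ x y' = R ∧ C₁ x R y'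
  let B : W → Finset Y := fun R => Finset.univ.filter fun y => ∃ x', ρ x' y = R ∧ C₂ y R x'
  have hA : ∀ R, (A R).card ≤ Fintype.card X := fun R => Finset.card_le_univ _
  have hB : ∀ R, (B R).card ≤ Fintype.card Y := fun R => Finset.card_le_univ _
  -- decodable pairs
  have hcover : Fintype.card X * Fintype.card Y ≤
      B₀.card + ∑ R ∈ 𝓡, (A R).card + ∑ R ∈ 𝓡, (B R).card := by
    -- A pair decodable from `x` is recovered from its record and `x`, by `hC₁`.
    have e1 : (Finset.univ.filter fun p : X × Y => C₁ p.1 (ρ p.1 p.2) p.2).card ≤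
        ∑ R ∈ 𝓡, (A R).card := by
      rw [← Finset.card_sigma]
      refine Finset.card_le_card_of_injOn (fun p => ⟨ρ p.1 p.2, p.1⟩) ?_ ?_
      · rintro ⟨x, y⟩ h
        simp only [Finset.coe_filter, Finset.mem_univ, true_and, Set.mem_ofPred_eq] at h
        simp only [Finset.coe_sigma, Set.mem_sigma_iff, Finset.mem_coe]
        exact ⟨mem𝓡 x y, by simpa [A] using ⟨y, rfl, h⟩⟩
      · rintro ⟨x, y⟩ h ⟨x', y'⟩ h' e
        simp only [Finset.coe_filter, Finset.mem_univ, true_and, Set.mem_ofPred_eq] at h h'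
        simp only [Sigma.mk.injEq, heq_eq_eq] at e
        obtain ⟨e1, rfl⟩ := e
        rw [← e1] at h'
        rw [hC₁ _ _ _ _ h h']
    have e2 : (Finset.univ.filter fun p : X × Y => C₂ p.2 (ρ p.1 p.2) p.1).card ≤
        ∑ R ∈ 𝓡, (B R).card := by
      rw [← Finset.card_sigma]
      refine Finset.card_le_card_of_injOn (fun p => ⟨ρ p.1 p.2, p.2⟩) ?_ ?_
      · rintro ⟨x, y⟩ h
        simp only [Finset.coe_filter, Finset.mem_univ, true_and, Set.mem_ofPred_eq] at h
        simp only [Finset.coe_sigma, Set.mem_sigma_iff, Finset.mem_coe]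
        exact ⟨mem𝓡 x y, by simpa [B] using ⟨x, rfl, h⟩⟩
      · rintro ⟨x, y⟩ h ⟨x', y'⟩ h' e
        simp only [Finset.coe_filter, Finset.mem_univ, true_and, Set.mem_ofPred_eq] at h h'
        simp only [Sigma.mk.injEq, heq_eq_eq] at e
        obtain ⟨e1, rfl⟩ := e
        rw [← e1] at h'
        rw [hC₂ _ _ _ _ h h']
    have e3 : (Finset.univ : Finset (X × Y)) ⊆
        B₀ ∪ (Finset.univ.filter fun p : X × Y => C₁ p.1 (ρ p.1 p.2) p.2) ∪
          (Finset.univ.filter fun p : X × Y => C₂ p.2 (ρ p.1 p.2) p.1) := by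
      rintro ⟨x, y⟩ -
      by_cases h : (x, y) ∈ B₀
      · simp [h]
      · rcases h₀ x y h with h | h <;> simp [h]
    have e4 := Finset.card_le_card e3
    rw [Finset.card_univ, Fintype.card_prod] at e4
    have e5 := (Finset.card_union_le (B₀ ∪ (Finset.univ.filter fun p : X × Y =>
      C₁ p.1 (ρ p.1 p.2) p.2)) (Finset.univ.filter fun p : X × Y => C₂ p.2 (ρ p.1 p.2) p.1))
    have e6 := Finset.card_union_le B₀ (Finset.univ.filter fun p : X × Y => C₁ p.1 (ρ p.1 p.2) p.2)
    omega
  -- triples that are decodable from both sides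
  have htriples : ∑ R ∈ 𝓡, (A R).card * (B R).card ≤
      B₁.card + B₂.card + Fintype.card X * Fintype.card Y := by
    have c1 : ∀ R x, ∃ y', x ∈ A R → ρ x y' = R ∧ C₁ x R y' := by
      intro R x
      by_cases h : x ∈ A R
      · obtain ⟨y', h'⟩ := (Finset.mem_filter.1 h).2
        exact ⟨y', fun _ => h'⟩
      · have : Nonempty Y := Fintype.card_pos_iff.1 (by omega)
        exact ⟨Classical.arbitrary Y, fun h' => absurd h' h⟩
    have c2 : ∀ R y, ∃ x', y ∈ B R → ρ x' y = R ∧ C₂ y R x' := by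
      intro R y
      by_cases h : y ∈ B R
      · obtain ⟨x', h'⟩ := (Finset.mem_filter.1 h).2
        exact ⟨x', fun _ => h'⟩
      · have : Nonempty X := Fintype.card_pos_iff.1 (by omega)
        exact ⟨Classical.arbitrary X, fun h' => absurd h' h⟩
    choose f hf using c1
    choose g hg using c2
    -- For a triple in `T`, the record arises both from `(x, y')` and from `(x', y)`. The triple is
    -- recovered from `(x, y, y')` since `R = ρ x y'`, and from `(x, y, x')` since `R = ρ x' y`.
    -- Outside the two exceptional sets `h₁` gives `R = ρ x y`, so that `(x, y)` determines it.
    let T : Finset (Σ _ : W, X × Y) := 𝓡.sigma fun R => A R ×ˢ B R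
    have hT : T.card = ∑ R ∈ 𝓡, (A R).card * (B R).card := by
      simp [T, Finset.card_sigma]
    have memT : ∀ t ∈ T, t.2.1 ∈ A t.1 ∧ t.2.2 ∈ B t.1 := by
      intro t ht
      simpa [T] using (Finset.mem_sigma.1 ht).2
    rw [← hT]
    have e1 : (T.filter fun t => (t.2.1, t.2.2, f t.1 t.2.1) ∈ B₁).card ≤ B₁.card := by
      refine Finset.card_le_card_of_injOn (fun t => (t.2.1, t.2.2, f t.1 t.2.1)) ?_ ?_
      · intro t ht
        exact (Finset.mem_filter.1 ht).2
      · rintro ⟨R, x, y⟩ ht ⟨R', x', y'⟩ ht' e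
        have h := hf _ _ (memT _ (Finset.mem_filter.1 ht).1).1
        have h' := hf _ _ (memT _ (Finset.mem_filter.1 ht').1).1
        simp only [Prod.mk.injEq] at e h h'
        obtain ⟨rfl, rfl, e⟩ := e
        rw [← e] at h'
        obtain rfl := h.1.symm.trans h'.1
        rfl
    have e2 : (T.filter fun t => (t.2.1, t.2.2, g t.1 t.2.2) ∈ B₂).card ≤ B₂.card := by
      refine Finset.card_le_card_of_injOn (fun t => (t.2.1, t.2.2, g t.1 t.2.2)) ?_ ?_
      · intro t ht
        exact (Finset.mem_filter.1 ht).2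
      · rintro ⟨R, x, y⟩ ht ⟨R', x', y'⟩ ht' e
        have h := hg _ _ (memT _ (Finset.mem_filter.1 ht).1).2
        have h' := hg _ _ (memT _ (Finset.mem_filter.1 ht').1).2
        simp only [Prod.mk.injEq] at e h h'
        obtain ⟨rfl, rfl, e⟩ := e
        rw [← e] at h'
        obtain rfl := h.1.symm.trans h'.1
        rfl
    have e3 : (T.filter fun t => t.1 = ρ t.2.1 t.2.2).card ≤ Fintype.card X * Fintype.card Y := by
      rw [← Fintype.card_prod, ← Finset.card_univ]
      refine Finset.card_le_card_of_injOn (fun t => t.2) (fun t ht => Finset.mem_univ _) ?_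
      rintro ⟨R, p⟩ ht ⟨R', p'⟩ ht' e
      have h := (Finset.mem_filter.1 ht).2
      have h' := (Finset.mem_filter.1 ht').2
      simp only at e h h'
      subst e
      rw [h, h']
    have e4 : T ⊆ (T.filter fun t => (t.2.1, t.2.2, f t.1 t.2.1) ∈ B₁) ∪
        (T.filter fun t => (t.2.1, t.2.2, g t.1 t.2.2) ∈ B₂) ∪
        (T.filter fun t => t.1 = ρ t.2.1 t.2.2) := by
      rintro ⟨R, x, y⟩ ht
      by_cases k1 : (x, y, f R x) ∈ B₁
      · simp [ht, k1]
      by_cases k2 : (x, y, g R y) ∈ B₂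
      · simp [ht, k2]
      have hx := hf _ _ (memT _ ht).1
      have hy := hg _ _ (memT _ ht).2
      simp only at hx hy
      have := h₁ x y (g R y) (f R x) k1 k2 (hx.1.trans hy.1.symm) (hx.1.symm ▸ hx.2)
      have hR : R = ρ x y := by rw [← this]; exact hx.1.symm
      simp only [Finset.mem_union, Finset.mem_filter]
      exact Or.inr ⟨ht, hR⟩
    have e5 := Finset.card_le_card e4
    have e6 := Finset.card_union_le ((T.filter fun t => (t.2.1, t.2.2, f t.1 t.2.1) ∈ B₁) ∪
        (T.filter fun t => (t.2.1, t.2.2, g t.1 t.2.2) ∈ B₂))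
        (T.filter fun t => t.1 = ρ t.2.1 t.2.2)
    have e7 := Finset.card_union_le (T.filter fun t => (t.2.1, t.2.2, f t.1 t.2.1) ∈ B₁)
        (T.filter fun t => (t.2.1, t.2.2, g t.1 t.2.2) ∈ B₂)
    omega
  generalize Fintype.card X = K at *
  generalize Fintype.card Y = L at *
  generalize B₀.card = b₀ at *
  generalize B₁.card = b₁ at *
  generalize B₂.card = b₂ at *
  rcases hXY with rfl | hKL
  -- This is the sum over `R` of `(K - |A R|) * (K - |B R|) ≥ 0`. The left side is at least `0.99
  -- K³`, the right side at most `0.02 K³ + K² + K³ / 2`, which is impossible for `K ≥ 3`.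
  · have hprod : K * (∑ R ∈ 𝓡, (A R).card + ∑ R ∈ 𝓡, (B R).card) ≤
        ∑ R ∈ 𝓡, (A R).card * (B R).card + 𝓡.card * (K * K) := by
      rw [← Finset.sum_add_distrib, Finset.mul_sum, ← smul_eq_mul (a := 𝓡.card),
        ← Finset.sum_const, ← Finset.sum_add_distrib]
      refine Finset.sum_le_sum fun R _ => ?_
      obtain ⟨u, hu⟩ := Nat.exists_eq_add_of_le (hA R)
      obtain ⟨v, hv⟩ := Nat.exists_eq_add_of_le (hB R)
      have : K * K = ((A R).card + u) * ((B R).card + v) := by rw [← hu, ← hv]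
      nlinarith [Nat.zero_le (u * v)]
    generalize ∑ R ∈ 𝓡, (A R).card * (B R).card = t at *
    generalize ∑ R ∈ 𝓡, (A R).card = a at *
    generalize ∑ R ∈ 𝓡, (B R).card = b at *
    generalize 𝓡.card = N at *
    have h1 : K * (K * K) ≤ K * b₀ + K * (a + b) := by
      rw [← mul_add]; exact Nat.mul_le_mul_left K (by omega)
    have h2 : K * (100 * b₀) ≤ K * (K * K) := Nat.mul_le_mul_left K hB₀
    have h3 : 2 * N * (K * K) ≤ K * (K * K) := Nat.mul_le_mul_right _ hN
    have h4 : 3 * (K * K) ≤ K * (K * K) := Nat.mul_le_mul_right _ hX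
    have h5 : K * (100 * b₀) = 100 * (K * b₀) := by ring
    have h6 : 2 * N * (K * K) = 2 * (N * (K * K)) := by ring
    have h7 : K * K * K = K * (K * K) := by ring
    have h8 : 0 < K * K := Nat.mul_pos (by omega) (by omega)
    omega
  -- For `L ≥ 2K` the trivial bounds suffice: at most `|𝓡| (K + L) ≤ K (K + L) / 2 ≤ 3KL / 4` pairs
  -- are decodable.
  · have h1 : ∑ R ∈ 𝓡, (A R).card ≤ 𝓡.card * K := by
      simpa using Finset.sum_le_card_nsmul 𝓡 (fun R => (A R).card) K fun R _ => hA R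
    have h2 : ∑ R ∈ 𝓡, (B R).card ≤ 𝓡.card * L := by
      simpa using Finset.sum_le_card_nsmul 𝓡 (fun R => (B R).card) L fun R _ => hB R
    have h3 : 2 * 𝓡.card * (K + L) ≤ K * (K + L) := Nat.mul_le_mul_right _ hN
    have h4 : K * (2 * K) ≤ K * L := Nat.mul_le_mul_left _ hKL
    have h5 : 0 < K * L := Nat.mul_pos (by omega) (by omega)
    have h6 : 2 * 𝓡.card * (K + L) = 2 * (𝓡.card * K + 𝓡.card * L) := by ring
    have h7 : K * (K + L) = K * K + K * L := by ring
    have h8 : K * (2 * K) = 2 * (K * K) := by ring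
    omega

/-- There are at most `2 ^ L` bit strings shorter than `L`. -/
lemma card_le_two_pow_of_injOn {W : Type*} (s : Finset W) (enc : W → List Bool) (L : ℕ)
    (henc : Set.InjOn enc s) (hlen : ∀ w ∈ s, (enc w).length < L) : s.card ≤ 2 ^ L := by
  have : Fintype.card (Fin L → Bool) = 2 ^ L := by simp
  rw [← this, ← Finset.card_univ]
  -- Append `true` and pad with `false` up to length `L`; the last `true` marks the end of the
  -- string.
  refine Finset.card_le_card_of_injOn
    (fun w i => (enc w ++ [true]).getD i.val false) (fun _ _ => Finset.mem_univ _) ?_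
  intro w hw w' hw' e
  refine henc hw hw' ?_
  have key : ∀ l l' : List Bool, l.length < L → l'.length < L →
      (∀ i < L, (l ++ [true]).getD i false = (l' ++ [true]).getD i false) →
      l'.length ≤ l.length := by
    intro l l' hl hl' h
    by_contra! hlt
    have := h l'.length hl'
    rw [List.getD_append_right _ _ _ _ le_rfl, List.getD_eq_default _ _ (by simp; omega)] at this
    simp at this
  have e' : ∀ i < L, (enc w ++ [true]).getD i false = (enc w' ++ [true]).getD i false :=
    fun i hi => congrFun e ⟨i, hi⟩
  have hlen' : (enc w).length = (enc w').length :=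
    le_antisymm (key _ _ (hlen _ hw') (hlen _ hw) fun i hi => (e' i hi).symm)
      (key _ _ (hlen _ hw) (hlen _ hw') e')
  refine List.ext_getElem hlen' fun i h1 h2 => ?_
  have := e' i (h1.trans (hlen _ hw))
  rwa [List.getD_append _ _ _ _ h1, List.getD_append _ _ _ _ h2, List.getD_eq_getElem _ _ h1,
    List.getD_eq_getElem _ _ h2] at this

/-! ### Split executions

The validators are divided into two sides by `σ : Fin n → Bool`. In a split execution each side
runs the protocol among itself, and learns about the other side only from the record. -/

/-- The part of a record from before slot `r`. -/
def Record.upto {n : ℕ} (R : Record n) (r : ℕ) : Record n := R.filter fun e => e.1 < r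

section Split

variable {n : ℕ} (S : System n) (σ : Fin n → Bool) (k : ℕ) (s : Data × (Fin n → Data))
  (z : Fin n → List Bool)

/-- The broadcast of a validator with a given view. -/
def castMsg (r : ℕ) (u : Fin n) (view : Data) : Data :=
  (S.protocol.next (Data.ofList
    [Data.ofNat k, s.1, Data.ofNat u.val, s.2 u, Data.ofBits (z u), view])).fst.cut
      (S.protocol.msgBound.eval (k + r))

/-- The message to the service of a validator with a given view. -/
def submitMsg (r : ℕ) (u : Fin n) (view : Data) : Data :=
  (S.protocol.next (Data.ofList
    [Data.ofNat k, s.1, Data.ofNat u.val, s.2 u, Data.ofBits (z u), view])).snd.cut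
      (S.protocol.msgBound.eval (k + r))

/-- The view in slot `0`. -/
def initView (n : ℕ) : Data :=
  Data.ofList [Data.cons (inboxData fun _ : Fin n => []) (Record.toData ([] : Record n))]

/-- The view of the members of a side in a given slot, when the final record is `R`. -/
def splitView (R : Record n) : ℕ → Bool → Data
  | 0, _ => initView n
  | r + 1, b =>
    Data.cons (Data.cons
      (inboxData fun u => if σ u = b then [castMsg S k s z r u (splitView R r (σ u))] else [])
      (R.upto (r + 1)).toData) (splitView R r b)

/-- The view of a client that hears both sides. -/
def jointView (R : Record n) : ℕ → Data
  | 0 => initView n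
  | r + 1 =>
    Data.cons (Data.cons
      (inboxData fun u => [castMsg S k s z r u (splitView S σ k s z R r (σ u))])
      (R.upto (r + 1)).toData) (jointView R r)

/-- The submissions in a split execution with record `R` so far. -/
def splitSubs (R : Record n) (r : ℕ) (u : Fin n) : Data :=
  submitMsg S k s z r u (splitView S σ k s z R r (σ u))

/-- The record of a split execution. -/
def splitRecord : ℕ → Record n
  | 0 => []
  | r + 1 =>
    splitRecord r ++ ((S.service k).accept r (splitRecord r)
      (splitSubs S σ k s z (splitRecord r) r)).map
        fun v => (r, v, splitSubs S σ k s z (splitRecord r) r v)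

/-- To the service a split execution is just a sequence of submissions, so the data limit and the
injectivity of the encoding apply to its record. -/
lemma splitRecord_eq_record (r : ℕ) : splitRecord S σ k s z r =
    (S.service k).record (fun r u => splitSubs S σ k s z (splitRecord S σ k s z r) r u) r := by
  unfold Service.record
  induction r with
  | zero => rfl
  | succ r ih => rw [splitRecord, recordOf, ← ih]

lemma lt_of_mem_splitRecord {r : ℕ} {e : ℕ × Fin n × Data}
    (he : e ∈ splitRecord S σ k s z r) : e.1 < r := by
  induction r with
  | zero => simp [splitRecord] at he
  | succ r ih =>
    rw [splitRecord, List.mem_append, List.mem_map] at he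
    rcases he with he | ⟨v, -, rfl⟩
    · exact (ih he).trans (Nat.lt_succ_self r)
    · exact Nat.lt_succ_self r

/-- Entries carry their slots and later slots only append. The final record thus contains all
earlier ones, and equality of final records yields equality of everything seen before. -/
lemma upto_splitRecord {r h : ℕ} (hr : r ≤ h) :
    (splitRecord S σ k s z h).upto r = splitRecord S σ k s z r := by
  induction h, hr using Nat.le_induction with
  | base =>
    exact List.filter_eq_self.2 fun e he => by simpa using lt_of_mem_splitRecord S σ k s z he
  | succ h hr ih =>
    rw [splitRecord, Record.upto, List.filter_append]
    have : List.filter (fun e : ℕ × Fin n × Data => decide (e.1 < r))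
        (((S.service k).accept h (splitRecord S σ k s z h)
          (splitSubs S σ k s z (splitRecord S σ k s z h) h)).map
            fun v => (h, v, splitSubs S σ k s z (splitRecord S σ k s z h) h v)) = [] := by
      rw [List.filter_eq_nil_iff]
      intro e he
      obtain ⟨v, -, rfl⟩ := List.mem_map.1 he
      simpa using hr
    rw [this, List.append_nil]
    exact ih

/-! ### What the views in a split execution depend on -/

variable {S σ k s z}

lemma splitView_congr_record {R R' : Record n} {r : ℕ} (h : ∀ t ≤ r, R.upto t = R'.upto t)
    (b : Bool) : splitView S σ k s z R r b = splitView S σ k s z R' r b := by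
  induction r generalizing b with
  | zero => rfl
  | succ r ih =>
    have := ih fun t ht => h t (by omega)
    simp only [splitView, this, h (r + 1) le_rfl]

lemma jointView_congr_record {R R' : Record n} {r : ℕ} (h : ∀ t ≤ r, R.upto t = R'.upto t) :
    jointView S σ k s z R r = jointView S σ k s z R' r := by
  induction r with
  | zero => rfl
  | succ r ih =>
    have h1 := ih fun t ht => h t (by omega)
    have h2 := splitView_congr_record (S := S) (σ := σ) (k := k) (s := s) (z := z) (R := R)
      (R' := R') (r := r) fun t ht => h t (by omega)
    simp only [jointView, h1, h2, h (r + 1) le_rfl]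

lemma castMsg_congr {z' : Fin n → List Bool} {u : Fin n} (h : z u = z' u) (r : ℕ)
    (view : Data) : castMsg S k s z r u view = castMsg S k s z' r u view := by
  simp only [castMsg, h]

/-- Messages of the other side are left out of the inbox; given the record, its inputs have no
further influence. -/
lemma splitView_congr_input {z' : Fin n → List Bool} {b : Bool} (h : ∀ u, σ u = b → z u = z' u)
    (R : Record n) (r : ℕ) : splitView S σ k s z R r b = splitView S σ k s z' R r b := by
  induction r with
  | zero => rfl
  | succ r ih =>
    simp only [splitView, ih]
    congr 3
    funext u
    by_cases hu : σ u = b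
    · simp only [hu, if_true, ih, castMsg_congr (h u hu)]
    · simp only [hu, if_false]

lemma splitView_upto {t r h : ℕ} (ht : t ≤ r) (hr : r ≤ h) (z' : Fin n → List Bool) (b : Bool) :
    splitView S σ k s z (splitRecord S σ k s z' r) t b =
      splitView S σ k s z (splitRecord S σ k s z' h) t b :=
  splitView_congr_record (fun q hq => by
    rw [upto_splitRecord _ _ _ _ _ (hq.trans ht), upto_splitRecord _ _ _ _ _ ((hq.trans ht).trans hr)]) b

lemma jointView_upto {t r h : ℕ} (ht : t ≤ r) (hr : r ≤ h) (z' : Fin n → List Bool) :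
    jointView S σ k s z (splitRecord S σ k s z' r) t =
      jointView S σ k s z (splitRecord S σ k s z' h) t :=
  jointView_congr_record fun q hq => by
    rw [upto_splitRecord _ _ _ _ _ (hq.trans ht), upto_splitRecord _ _ _ _ _ ((hq.trans ht).trans hr)]

/-! ### Size bounds -/

lemma size_castMsg_le (r : ℕ) (u : Fin n) (view : Data) :
    (castMsg S k s z r u view).size ≤ S.protocol.msgBound.eval (k + r) + 1 :=
  Data.size_cut_le _ _

lemma size_submitMsg_le (r : ℕ) (u : Fin n) (view : Data) :
    (submitMsg S k s z r u view).size ≤ S.protocol.msgBound.eval (k + r) + 1 :=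
  Data.size_cut_le _ _

lemma size_ofList_singleton (d : Data) : (Data.ofList [d]).size = d.size + 2 := by
  simp [Data.ofList, Data.size]

lemma size_inboxData_le {inbox : Fin n → List Data} {B : ℕ}
    (h : ∀ u, inbox u = [] ∨ ∃ d, inbox u = [d] ∧ d.size ≤ B) :
    (inboxData inbox).size ≤ n * (B + 3) + 1 := by
  refine Data.size_ofFn_le _ (B + 2) fun u => ?_
  rcases h u with h | ⟨d, h, hd⟩
  · rw [h]; simp [Data.ofList, Data.size]
  · rw [h, size_ofList_singleton]; omega

/-- A bound on the size of the record before slot `r`, as a polynomial in `k + r`. -/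
noncomputable def recordBound (S : System n) : Polynomial ℕ :=
  Polynomial.X * Polynomial.C n *
    (2 * Polynomial.X + S.protocol.msgBound + Polynomial.C (2 * n + 20)) + 1

lemma length_splitRecord_le (r : ℕ) : (splitRecord S σ k s z r).length ≤ r * n := by
  induction r with
  | zero => simp [splitRecord]
  | succ r ih =>
    have := ((S.service k).accept_nodup r (splitRecord S σ k s z r)
      (splitSubs S σ k s z (splitRecord S σ k s z r) r)).length_le_card
    rw [Fintype.card_fin] at this
    rw [splitRecord, List.length_append, List.length_map, add_mul, one_mul]
    omega

lemma size_le_of_mem_splitRecord {r : ℕ} {e : ℕ × Fin n × Data}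
    (he : e ∈ splitRecord S σ k s z r) :
    e.2.2.size ≤ S.protocol.msgBound.eval (k + r) + 1 := by
  induction r with
  | zero => simp [splitRecord] at he
  | succ r ih =>
    have hmono := eval_mono S.protocol.msgBound (show k + r ≤ k + (r + 1) by omega)
    simp only at hmono
    rw [splitRecord, List.mem_append, List.mem_map] at he
    rcases he with he | ⟨v, -, rfl⟩
    · have := ih he
      omega
    · have := size_submitMsg_le (S := S) (k := k) (s := s) (z := z) r v
        (splitView S σ k s z (splitRecord S σ k s z r) r (σ v))
      simp only [splitSubs]
      omega

lemma size_toData_splitRecord_le (r : ℕ) :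
    (splitRecord S σ k s z r).toData.size ≤ (recordBound S).eval (k + r) := by
  have h := Data.size_ofList_le ((splitRecord S σ k s z r).map fun e =>
    Data.ofList [Data.ofNat e.1, Data.ofNat e.2.1.val, e.2.2])
    (2 * (k + r) + 2 * n + S.protocol.msgBound.eval (k + r) + 19) (by
      intro a ha
      obtain ⟨e, he, rfl⟩ := List.mem_map.1 ha
      have h1 := lt_of_mem_splitRecord _ _ _ _ _ he
      have h2 := size_le_of_mem_splitRecord he
      have h3 := Data.size_ofNat e.1
      have h4 := Data.size_ofNat e.2.1.val
      have h5 := e.2.1.2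
      simp only [Data.ofList, Data.size]
      omega)
  rw [List.length_map] at h
  refine h.trans ?_
  have hl := length_splitRecord_le (S := S) (σ := σ) (k := k) (s := s) (z := z) r
  simp only [recordBound, Polynomial.eval_add, Polynomial.eval_mul, Polynomial.eval_X,
    Polynomial.eval_C, Polynomial.eval_one, Polynomial.eval_ofNat]
  have : (splitRecord S σ k s z r).length ≤ (k + r) * n := by nlinarith
  refine Nat.add_le_add_right (Nat.mul_le_mul this ?_) 1
  omega

/-- A bound on the size of a view in slot `r`, as a polynomial in `k + r`. -/
noncomputable def viewBound (S : System n) : Polynomial ℕ :=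
  (Polynomial.X + 1) *
    (Polynomial.C n * (S.protocol.msgBound + 4) + recordBound S + Polynomial.C (n + 10))

lemma size_initView_le : (initView n).size ≤ n * 4 + 10 := by
  have := size_inboxData_le (inbox := fun _ : Fin n => []) (B := 0) fun u => Or.inl rfl
  simp only [initView, Data.ofList, Data.size, Record.toData, List.map_nil]
  omega

/-- Serves both kinds of views. Each slot adds at most one bounded message per sender and one
record; by monotonicity the bounds at `N = k + r` hold for all slots up to `r`. -/
lemma size_view_le_of_step {V : ℕ → Data} (h0 : V 0 = initView n) {h : ℕ} (z' : Fin n → List Bool)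
    (hV : ∀ r, ∃ inbox : Fin n → List Data, (∀ u, inbox u = [] ∨ ∃ d, inbox u = [d] ∧
        d.size ≤ S.protocol.msgBound.eval (k + r) + 1) ∧
      V (r + 1) = Data.cons (Data.cons (inboxData inbox)
        ((splitRecord S σ k s z' h).upto (r + 1)).toData) (V r)) {r : ℕ} (hr : r ≤ h) :
    (V r).size ≤ (viewBound S).eval (k + r) := by
  have key : ∀ N t, k + t ≤ N → t ≤ h → (V t).size ≤ (t + 1) *
      (n * (S.protocol.msgBound.eval N + 4) + (recordBound S).eval N + (n + 10)) := by
    intro N t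
    induction t with
    | zero =>
      intro _ _
      have := size_initView_le (n := n)
      rw [h0]
      nlinarith [Nat.zero_le (n * S.protocol.msgBound.eval N), Nat.zero_le ((recordBound S).eval N)]
    | succ t ih =>
      intro hN ht
      obtain ⟨inbox, h1, h2⟩ := hV t
      have h3 := size_inboxData_le h1
      have h4 := ih (by omega) (by omega)
      have h5 := eval_mono S.protocol.msgBound (show k + t ≤ N by omega)
      have h6 := size_toData_splitRecord_le (S := S) (σ := σ) (k := k) (s := s) (z := z') (t + 1)
      have h7 := eval_mono (recordBound S) hN
      simp only at h5 h7
      rw [h2, upto_splitRecord _ _ _ _ _ ht]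
      have h8 : n * (S.protocol.msgBound.eval (k + t) + 1 + 3) ≤
        n * (S.protocol.msgBound.eval N + 4) := Nat.mul_le_mul_left _ (by omega)
      simp only [Data.size]
      rw [add_mul (t + 1) 1, one_mul]
      omega
  refine (key (k + r) r le_rfl hr).trans ?_
  simp only [viewBound, Polynomial.eval_add, Polynomial.eval_mul, Polynomial.eval_X,
    Polynomial.eval_C, Polynomial.eval_one, Polynomial.eval_ofNat]
  exact Nat.mul_le_mul_right _ (by omega)

lemma size_splitView_le (z' : Fin n → List Bool) (b : Bool) {r h : ℕ} (hr : r ≤ h) :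
    (splitView S σ k s z (splitRecord S σ k s z' h) r b).size ≤ (viewBound S).eval (k + r) := by
  refine size_view_le_of_step (σ := σ) (s := s)
    (V := fun r => splitView S σ k s z (splitRecord S σ k s z' h) r b) rfl z'
    (fun r => ⟨_, fun u => ?_, rfl⟩) hr
  split_ifs
  · exact Or.inr ⟨_, rfl, size_castMsg_le _ _ _⟩
  · exact Or.inl rfl

lemma size_jointView_le (z' : Fin n → List Bool) {r h : ℕ} (hr : r ≤ h) :
    (jointView S σ k s z (splitRecord S σ k s z' h) r).size ≤ (viewBound S).eval (k + r) :=
  size_view_le_of_step (σ := σ) (s := s)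
    (V := fun r => jointView S σ k s z (splitRecord S σ k s z' h) r) rfl z'
    (fun _ => ⟨_, fun _ => Or.inr ⟨_, rfl, size_castMsg_le _ _ _⟩, rfl⟩) hr

end Split

/-! ### The adversary that runs one side of a split execution twice -/

section SplitAdversary

variable {n : ℕ} (S : System n) (σ : Fin n → Bool) (c mix : Bool) (pf : Data → Data)

/-- The view of the copy of the corrupted side that writes to the service. -/
def submittingView (d : Data) : Data :=
  Data.cons (Data.cons
    (Data.ofFn fun u => if σ u = c then ((d.get 3).get 2).get u.val else Data.nil) (d.get 4))
    ((d.get 1).get 0)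

/-- The view of the copy of the corrupted side whose messages the clients receive. -/
def pretendedView (d : Data) : Data :=
  Data.cons (Data.cons
    (Data.ofFn fun u => if σ u = c then ((d.get 3).get 0).get u.val else Data.nil) (d.get 4))
    ((d.get 1).get 1)

/-- The view of client `0`. -/
def observedView (d : Data) : Data :=
  Data.cons (Data.cons ((d.get 3).get 0) (d.get 4)) ((d.get 1).get 2)

/-- The input used by the submitting copy. -/
def submittedInput (u : Fin n) (info : Data) : Data :=
  if mix = true then slice n u.val (info.get 2) else ((info.get 3).get u.val).snd

def simulatedOut (u : Fin n) (info input view : Data) : Data :=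
  S.protocol.next (Data.ofList
    [info.get 0, info.get 1, Data.ofNat u.val, ((info.get 3).get u.val).fst, input, view])

/-- The step function of the adversary: it runs two copies of side `c`, and shows the proof
computed by `pf`. -/
def splitStep (d : Data) : Data :=
  Data.ofList
    [Data.ofList [submittingView σ c d, pretendedView σ c d, observedView d],
      Data.ofFn fun u => if σ u = c then
        (simulatedOut S u (d.get 0) (submittedInput mix u (d.get 0)) (submittingView σ c d)).snd
        else Data.nil,
      Data.nil,
      -- Each copy reads the messages of its own members back from a client's inbox: that of client
      -- `0` for the pretended copy, of client `2` for the submitting one. The network thereby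
      -- performs the truncation at `msgBound`, which the step function need not compute.
      Data.ofList
        [Data.ofFn fun u => if σ u = c then
          Data.ofList [(simulatedOut S u (d.get 0) (((d.get 0).get 3).get u.val).snd
            (pretendedView σ c d)).fst] else Data.nil,
          Data.nil,
          Data.ofFn fun u => if σ u = c then
            Data.ofList [(simulatedOut S u (d.get 0) (submittedInput mix u (d.get 0))
              (submittingView σ c d)).fst] else Data.nil],
      -- Empty delay tables give the least delay, one slot. Corrupted validators hand over empty
      -- transcripts, in accordance with `transcriptTable`.
      Data.nil, Data.nil, Data.nil,
      pf (Data.ofList [(d.get 0).get 0, (d.get 0).get 1, pretendedView σ c d, observedView d,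
        (d.get 0).get 3])]

lemma polyTime_submittingView : PolyTime (submittingView σ c) :=
  ((PolyTime.ofFn fun u => (((PolyTime.id.get 3).get 2).get u.val).ite PolyTime.nil).cons
    (PolyTime.id.get 4)).cons ((PolyTime.id.get 1).get 0)

lemma polyTime_pretendedView : PolyTime (pretendedView σ c) :=
  ((PolyTime.ofFn fun u => (((PolyTime.id.get 3).get 0).get u.val).ite PolyTime.nil).cons
    (PolyTime.id.get 4)).cons ((PolyTime.id.get 1).get 1)

lemma polyTime_observedView : PolyTime observedView :=
  (((PolyTime.id.get 3).get 0).cons (PolyTime.id.get 4)).cons ((PolyTime.id.get 1).get 2)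

lemma polyTime_submittedInput (u : Fin n) : PolyTime (submittedInput mix u) :=
  ((polyTime_slice u.2).comp (PolyTime.id.get 2)).ite ((PolyTime.id.get 3).get u.val).snd

variable {S} in
lemma polyTime_simulatedOut (u : Fin n) {f g h : Data → Data} (hf : PolyTime f)
    (hg : PolyTime g) (hh : PolyTime h) :
    PolyTime fun d => simulatedOut S u (f d) (g d) (h d) :=
  S.protocol.next_polyTime.comp
    ((hf.get 0).ofList_cons ((hf.get 1).ofList_cons ((PolyTime.const _).ofList_cons
      (((hf.get 3).get u.val).fst.ofList_cons (hg.ofList_cons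
        (hh.ofList_cons PolyTime.ofList_nil))))))

variable {pf} in
lemma polyTime_splitStep (hpf : PolyTime pf) : PolyTime (splitStep S σ c mix pf) := by
  have h1 := polyTime_submittingView σ c
  have h2 := polyTime_pretendedView σ c
  have h3 := polyTime_observedView
  have h4 : PolyTime fun d => d.get 0 := PolyTime.id.get 0
  have h5 : ∀ u : Fin n, PolyTime fun d => submittedInput mix u (d.get 0) :=
    fun u => (polyTime_submittedInput mix u).comp h4
  have h6 : ∀ u : Fin n, PolyTime fun d =>
      simulatedOut S u (d.get 0) (submittedInput mix u (d.get 0)) (submittingView σ c d) :=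
    fun u => polyTime_simulatedOut u h4 (h5 u) h1
  have h7 : ∀ u : Fin n, PolyTime fun d =>
      simulatedOut S u (d.get 0) (((d.get 0).get 3).get u.val).snd (pretendedView σ c d) :=
    fun u => polyTime_simulatedOut u h4 ((h4.get 3).get u.val).snd h2
  refine (h1.ofList_cons (h2.ofList_cons (h3.ofList_cons PolyTime.ofList_nil))).ofList_cons
    ((PolyTime.ofFn fun u => (h6 u).snd.ite PolyTime.nil).ofList_cons
    (PolyTime.nil.ofList_cons (PolyTime.ofList_cons ?_
    (PolyTime.nil.ofList_cons (PolyTime.nil.ofList_cons (PolyTime.nil.ofList_cons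
      (PolyTime.ofList_cons ?_ PolyTime.ofList_nil)))))))
  · exact (PolyTime.ofFn fun u =>
      ((h7 u).fst.ofList_cons PolyTime.ofList_nil).ite PolyTime.nil).ofList_cons
        (PolyTime.nil.ofList_cons ((PolyTime.ofFn fun u =>
          ((h6 u).fst.ofList_cons PolyTime.ofList_nil).ite PolyTime.nil).ofList_cons
            PolyTime.ofList_nil))
  · exact hpf.comp ((h4.get 0).ofList_cons ((h4.get 1).ofList_cons (h2.ofList_cons
      (h3.ofList_cons ((h4.get 3).ofList_cons PolyTime.ofList_nil)))))

noncomputable def setupBound (S : System n) : Polynomial ℕ := S.protocol.setup_bound.choose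

/-- A bound on the input of the adversary in slot `r`, as a polynomial in `k + r`. -/
noncomputable def stepInputBound (S : System n) : Polynomial ℕ :=
  (2 * Polynomial.X + setupBound S + 4 * (S.m * Polynomial.C n) +
      Polynomial.C n * (setupBound S + 4 * S.m + 4) + 20) +
    (3 * viewBound S + 10) +
    Polynomial.C n * (Polynomial.C n * (S.protocol.msgBound + 4) + 2) +
    3 * (Polynomial.C n * (S.protocol.msgBound + 4) + 2) +
    recordBound S + 2 * (Polynomial.C n * (S.protocol.msgBound + 2)) + 30

/-- The adversary that corrupts side `c`. Client `0` hears both sides, client `1` only the honest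
side; client `2` only serves the adversary as a mailbox. -/
noncomputable def splitAdversary (hpf : PolyTime pf) : Adversary n where
  corrupted := Finset.univ.filter fun u => σ u = c
  clients := 3
  join := fun _ _ => 0
  tapeLen := S.m * Polynomial.C n
  bound := (polyTime_splitStep S σ c mix hpf).exists_size_le.choose.comp (stepInputBound S)
  step := splitStep S σ c mix pf
  step_polyTime := polyTime_splitStep S σ c mix hpf

variable {pf} (hpf : PolyTime pf)

@[simp] lemma mem_corrupted_splitAdversary {u : Fin n} :
    u ∈ (splitAdversary S σ c mix pf hpf).corrupted ↔ σ u = c := by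
  simp [splitAdversary]

/-- The configuration that follows on `C`. -/
def nextConf {A : Adversary n} (k : ℕ) (ω : Outcome n) (r : ℕ) (C : Conf A) : Conf A :=
  let R : Record n := C.record ++
    ((S.service k).accept r C.record (submissions S A k ω r C)).map
      fun v => (r, v, submissions S A k ω r C v)
  let net : ℕ → Party A → Fin n → List Data := fun t w u =>
    if t = arrival S A k ω r C w u then C.net t w u ++ sent S A k ω r C w u else C.net t w u
  { state := (advOut S A k ω r C).get 0
    record := R
    net := net
    view := fun w => Data.cons (Data.cons (inboxData (net (r + 1) w)) R.toData) (C.view w) }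

lemma conf_succ {A : Adversary n} (k : ℕ) (ω : Outcome n) (r : ℕ) :
    conf S A k ω (r + 1) = nextConf S k ω r (conf S A k ω r) := rfl

/-- Sizes of the random choices, as they are in every execution. -/
structure Outcome.Bounded (k : ℕ) (ω : Outcome n) : Prop where
  pub : ω.pub.size ≤ (setupBound S).eval k
  priv : ∀ v, (ω.priv v).size ≤ (setupBound S).eval k
  input : ∀ v, (ω.input v).length ≤ S.m.eval k
  tape : ω.tape.length ≤ S.m.eval k * n

/-- The inputs `z` used for the record: those of the honest side are the true ones. -/
structure SubmittedInputs (ω : Outcome n) (z : Fin n → List Bool) : Prop where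
  honest : ∀ u, σ u ≠ c → z u = ω.input u
  corrupted : ∀ u, σ u = c → Data.ofBits (z u) =
    if mix = true then slice n u.val (Data.ofBits ω.tape) else Data.ofBits (ω.input u)

/-- In slot `r`, an execution with the adversary looks like a split execution. -/
structure Simulates (k : ℕ) (ω : Outcome n) (z : Fin n → List Bool) (r : ℕ)
    (C : Conf (splitAdversary S σ c mix pf hpf)) : Prop where
  record : C.record = splitRecord S σ k (ω.pub, ω.priv) z r
  joint : C.view (Sum.inr (0 : Fin 3)) = jointView S σ k (ω.pub, ω.priv) ω.input C.record r
  side : C.view (Sum.inr (1 : Fin 3)) = splitView S σ k (ω.pub, ω.priv) ω.input C.record r (!c)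
  honest : ∀ v, σ v ≠ c → C.view (Sum.inl v) =
    splitView S σ k (ω.pub, ω.priv) ω.input C.record r (!c)
  future : ∀ t, r < t → ∀ w u, C.net t w u = []
  now : ∀ w u, C.net r w u = [] ∨
    ∃ d, C.net r w u = [d] ∧ d.size ≤ S.protocol.msgBound.eval (k + r) + 1
  submitting : Data.cons (Data.cons (Data.ofFn fun u => if σ u = c then
      Data.ofList (C.net r (Sum.inr (2 : Fin 3)) u) else Data.nil) C.record.toData)
      (C.state.get 0) = splitView S σ k (ω.pub, ω.priv) z C.record r c
  pretended : Data.cons (Data.cons (Data.ofFn fun u => if σ u = c then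
      Data.ofList (C.net r (Sum.inr (0 : Fin 3)) u) else Data.nil) C.record.toData)
      (C.state.get 1) = splitView S σ k (ω.pub, ω.priv) ω.input C.record r c
  observed : Data.cons (Data.cons (inboxData (C.net r (Sum.inr (0 : Fin 3)))) C.record.toData)
      (C.state.get 2) = jointView S σ k (ω.pub, ω.priv) ω.input C.record r
  stateSize : C.state.size ≤ 3 * (viewBound S).eval (k + r) + 10

/-! ### The simulation invariant along an execution -/

variable {S σ c mix hpf}

lemma simulates_zero (k : ℕ) (ω : Outcome n) (z : Fin n → List Bool) :
    Simulates S σ c mix hpf k ω z 0 (conf S (splitAdversary S σ c mix pf hpf) k ω 0) where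
  record := rfl
  joint := rfl
  side := rfl
  honest _ _ := rfl
  future _ _ _ _ := rfl
  now _ _ := Or.inl rfl
  submitting := by
    simp [conf, splitView, initView, inboxData, Data.ofList]
  pretended := by
    simp [conf, splitView, initView, inboxData, Data.ofList]
  observed := by
    simp [conf, jointView, initView, inboxData, Data.ofList]
  stateSize := by
    simp [conf, Data.size]

/-- The input of the adversary in slot `r`. -/
def stepInput {A : Adversary n} (S : System n) (k : ℕ) (ω : Outcome n) (r : ℕ) (C : Conf A) :
    Data :=
  Data.ofList
    [advInfo A k ω, C.state,
      Data.ofFn fun v => inboxData (C.net r (Sum.inl v)),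
      Data.ofFn fun c => inboxData (C.net r (Sum.inr c)),
      C.record.toData,
      Data.ofFn (broadcast S A k ω r C),
      Data.ofFn (submission S A k ω r C)]

lemma size_advInfo_le {k : ℕ} {ω : Outcome n} (hω : ω.Bounded S k) :
    (advInfo (splitAdversary S σ c mix pf hpf) k ω).size ≤
      2 * k + (setupBound S).eval k + 4 * (S.m.eval k * n) +
        n * ((setupBound S).eval k + 4 * S.m.eval k + 4) + 20 := by
  have h1 := Data.size_ofNat k
  have h2 := hω.pub
  have h3 := Data.size_ofBits ω.tape
  have h4 := hω.tape
  have h5 := Data.size_ofFn_le (fun v => if v ∈ (splitAdversary S σ c mix pf hpf).corrupted then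
      Data.cons (ω.priv v) (Data.ofBits (ω.input v)) else Data.nil)
      ((setupBound S).eval k + 4 * S.m.eval k + 3) (by
    intro v
    split_ifs
    · have h6 := hω.priv v
      have h7 := Data.size_ofBits (ω.input v)
      have h8 := hω.input v
      simp only [Data.size]
      omega
    · simp [Data.size])
  rw [show (setupBound S).eval k + 4 * S.m.eval k + 3 + 1 =
    (setupBound S).eval k + 4 * S.m.eval k + 4 from rfl] at h5
  simp only [advInfo, Data.ofList, Data.size]
  omega

lemma Simulates.size_stepInput_le {k : ℕ} {ω : Outcome n} (hω : ω.Bounded S k)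
    {z : Fin n → List Bool} {r : ℕ} {C : Conf (splitAdversary S σ c mix pf hpf)}
    (h : Simulates S σ c mix hpf k ω z r C) :
    (stepInput S k ω r C).size ≤ (stepInputBound S).eval (k + r) := by
  have hk : k ≤ k + r := Nat.le_add_right k r
  have h1 := size_advInfo_le (σ := σ) (c := c) (mix := mix) (hpf := hpf) hω
  have h2 := eval_mono (setupBound S) hk
  have h3 := eval_mono S.m hk
  simp only at h2 h3
  have h4 : S.m.eval k * n ≤ S.m.eval (k + r) * n := Nat.mul_le_mul_right n h3
  have h5 : n * ((setupBound S).eval k + 4 * S.m.eval k + 4) ≤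
      n * ((setupBound S).eval (k + r) + 4 * S.m.eval (k + r) + 4) :=
    Nat.mul_le_mul_left n (by omega)
  have h6 := h.stateSize
  have h7 : ∀ w, (inboxData (C.net r w)).size ≤ n * (S.protocol.msgBound.eval (k + r) + 4) + 1 :=
    fun w => size_inboxData_le (h.now w)
  have h8 := Data.size_ofFn_le (fun v : Fin n => inboxData (C.net r (Sum.inl v))) _ fun v => h7 _
  have h9 : (Data.ofFn fun c => inboxData (C.net r (Sum.inr c))).size ≤
      3 * (n * (S.protocol.msgBound.eval (k + r) + 4) + 1 + 1) + 1 :=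
    Data.size_ofFn_le (fun c => inboxData (C.net r (Sum.inr c))) _ fun v => h7 _
  have h10 := size_toData_splitRecord_le (S := S) (σ := σ) (k := k) (s := (ω.pub, ω.priv))
    (z := z) r
  rw [← h.record] at h10
  have h11 := Data.size_ofFn_le (broadcast S (splitAdversary S σ c mix pf hpf) k ω r C)
      (S.protocol.msgBound.eval (k + r) + 1) (by
    intro v
    unfold broadcast
    split_ifs
    · simp [Data.size]
    · exact Data.size_cut_le _ _)
  have h12 := Data.size_ofFn_le (submission S (splitAdversary S σ c mix pf hpf) k ω r C)
      (S.protocol.msgBound.eval (k + r) + 1) (by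
    intro v
    unfold submission
    split_ifs
    · simp [Data.size]
    · exact Data.size_cut_le _ _)
  simp only [Nat.add_assoc, Nat.reduceAdd] at h8 h9 h11 h12
  simp only [stepInput, Data.ofList, Data.size, stepInputBound, Polynomial.eval_add,
    Polynomial.eval_mul, Polynomial.eval_X, Polynomial.eval_C, Polynomial.eval_ofNat]
  omega

/-- The bound of the adversary is the output bound of its step function composed with the bound on
the inputs that occur here, so nothing is truncated. -/
lemma Simulates.advOut_eq {k : ℕ} {ω : Outcome n} (hω : ω.Bounded S k)
    {z : Fin n → List Bool} {r : ℕ} {C : Conf (splitAdversary S σ c mix pf hpf)}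
    (h : Simulates S σ c mix hpf k ω z r C) :
    advOut S (splitAdversary S σ c mix pf hpf) k ω r C =
      splitStep S σ c mix pf (stepInput S k ω r C) := by
  refine Data.cut_of_le ?_
  refine ((polyTime_splitStep S σ c mix hpf).exists_size_le.choose_spec _).trans ?_
  refine (eval_mono (polyTime_splitStep S σ c mix hpf).exists_size_le.choose
    (h.size_stepInput_le hω)).trans (le_of_eq ?_)
  exact (Polynomial.eval_comp).symm

section Step

variable {k : ℕ} {ω : Outcome n} {z : Fin n → List Bool} {r : ℕ}
  {C : Conf (splitAdversary S σ c mix pf hpf)}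

lemma Simulates.submittingView_eq (h : Simulates S σ c mix hpf k ω z r C) :
    submittingView σ c (stepInput S k ω r C) =
      splitView S σ k (ω.pub, ω.priv) z C.record r c := by
  rw [← h.submitting]
  have : ∀ u : Fin n, (((stepInput S k ω r C).get 3).get 2).get u.val =
      Data.ofList (C.net r (Sum.inr (2 : Fin 3)) u) := by
    intro u
    have e := Data.get_ofFn (fun c : Fin 3 => inboxData (C.net r (Sum.inr c))) 2
    exact (congrArg (fun d => d.get u.val) e).trans (Data.get_ofFn _ u)
  simp only [submittingView, this]
  rfl

lemma Simulates.inbox_eq (k : ℕ) (ω : Outcome n) (r : ℕ)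
    (C : Conf (splitAdversary S σ c mix pf hpf)) :
    ((stepInput S k ω r C).get 3).get 0 = inboxData (C.net r (Sum.inr (0 : Fin 3))) :=
  Data.get_ofFn (fun c : Fin 3 => inboxData (C.net r (Sum.inr c))) 0

lemma Simulates.pretendedView_eq (h : Simulates S σ c mix hpf k ω z r C) :
    pretendedView σ c (stepInput S k ω r C) =
      splitView S σ k (ω.pub, ω.priv) ω.input C.record r c := by
  rw [← h.pretended]
  have : ∀ u : Fin n, (((stepInput S k ω r C).get 3).get 0).get u.val =
      Data.ofList (C.net r (Sum.inr (0 : Fin 3)) u) := by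
    intro u
    rw [Simulates.inbox_eq]
    exact Data.get_ofFn _ u
  simp only [pretendedView, this]
  rfl

lemma Simulates.observedView_eq (h : Simulates S σ c mix hpf k ω z r C) :
    observedView (stepInput S k ω r C) = jointView S σ k (ω.pub, ω.priv) ω.input C.record r := by
  rw [← h.observed, observedView, Simulates.inbox_eq]
  rfl

lemma advInfo_get_three {u : Fin n} (hu : σ u = c) :
    ((advInfo (splitAdversary S σ c mix pf hpf) k ω).get 3).get u.val =
      Data.cons (ω.priv u) (Data.ofBits (ω.input u)) := by
  simp [advInfo, Data.ofList, hu]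

/-- The corrupted side writes through its submitting copy, which uses `z`. On the honest side `z`
has the true inputs, and given the record the view there depends on no others. -/
lemma Simulates.submission_eq (h : Simulates S σ c mix hpf k ω z r C) (hω : ω.Bounded S k)
    (hz : SubmittedInputs σ c mix ω z) :
    submissions S (splitAdversary S σ c mix pf hpf) k ω r C =
      splitSubs S σ k (ω.pub, ω.priv) z C.record r := by
  funext u
  by_cases hu : σ u = c
  · rw [submissions, if_pos (by simpa using hu), h.advOut_eq hω]
    simp only [splitStep, Data.ofList, Data.get_cons_succ, Data.get_cons_zero, Data.get_ofFn]
    rw [if_pos hu, splitSubs, submitMsg, h.submittingView_eq, hu]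
    have e1 : ((stepInput S k ω r C).get 0) = advInfo (splitAdversary S σ c mix pf hpf) k ω := rfl
    have e2 : submittedInput mix u (advInfo (splitAdversary S σ c mix pf hpf) k ω) =
        Data.ofBits (z u) := by
      rw [hz.corrupted u hu, submittedInput, advInfo_get_three hu]
      rfl
    rw [e1, e2, simulatedOut, advInfo_get_three hu]
    rfl
  · rw [submissions, if_neg (by simpa using hu), submission, if_neg (by simpa using hu),
      validatorOut, h.honest u hu, splitSubs]
    have e : (!c) = σ u := by revert hu; cases σ u <;> cases c <;> simp
    rw [e, ← hz.honest u hu, splitView_congr_input (z' := z)]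
    · rfl
    · intro v hv
      exact (hz.honest v (by rw [hv]; exact hu)).symm

/-- All parties are present from slot `0`, and an empty delay reads as `0`, which `max 1` raises to
`1`. -/
lemma Simulates.arrival_eq (h : Simulates S σ c mix hpf k ω z r C) (hω : ω.Bounded S k)
    (w : Party (splitAdversary S σ c mix pf hpf)) (u : Fin n) :
    arrival S (splitAdversary S σ c mix pf hpf) k ω r C w u = r + 1 := by
  have e : joinSlot (splitAdversary S σ c mix pf hpf) k w = 0 := by
    rcases w with v | v <;> rfl
  have e4 : (advOut S (splitAdversary S σ c mix pf hpf) k ω r C).get 4 = Data.nil := by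
    rw [h.advOut_eq hω]; rfl
  have e5 : (advOut S (splitAdversary S σ c mix pf hpf) k ω r C).get 5 = Data.nil := by
    rw [h.advOut_eq hω]; rfl
  have e6 : ∀ w : Party (splitAdversary S σ c mix pf hpf),
      partyGet Data.nil Data.nil w = Data.nil := by
    rintro (v | v) <;> simp [partyGet]
  rw [arrival, e, e4, e5, e6, Data.get_nil]
  simp [Data.toNat, Data.toList]

lemma Simulates.sent_honest (h : Simulates S σ c mix hpf k ω z r C)
    (w : Party (splitAdversary S σ c mix pf hpf)) {u : Fin n} (hu : σ u ≠ c) :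
    sent S (splitAdversary S σ c mix pf hpf) k ω r C w u =
      [castMsg S k (ω.pub, ω.priv) ω.input r u
        (splitView S σ k (ω.pub, ω.priv) ω.input C.record r (σ u))] := by
  have e : (!c) = σ u := by revert hu; cases σ u <;> cases c <;> simp
  rw [sent, if_neg (by simpa using hu), broadcast, if_neg (by simpa using hu), validatorOut,
    h.honest u hu, e]
  rfl

lemma Simulates.sent_corrupted (h : Simulates S σ c mix hpf k ω z r C) (hω : ω.Bounded S k)
    (hz : SubmittedInputs σ c mix ω z) {u : Fin n} (hu : σ u = c) :
    (∀ v, sent S (splitAdversary S σ c mix pf hpf) k ω r C (Sum.inl v) u = []) ∧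
    sent S (splitAdversary S σ c mix pf hpf) k ω r C (Sum.inr (0 : Fin 3)) u =
      [castMsg S k (ω.pub, ω.priv) ω.input r u
        (splitView S σ k (ω.pub, ω.priv) ω.input C.record r c)] ∧
    sent S (splitAdversary S σ c mix pf hpf) k ω r C (Sum.inr (1 : Fin 3)) u = [] ∧
    sent S (splitAdversary S σ c mix pf hpf) k ω r C (Sum.inr (2 : Fin 3)) u =
      [castMsg S k (ω.pub, ω.priv) z r u
        (splitView S σ k (ω.pub, ω.priv) z C.record r c)] := by
  have e1 : ((stepInput S k ω r C).get 0) = advInfo (splitAdversary S σ c mix pf hpf) k ω := rfl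
  have e2 : submittedInput mix u (advInfo (splitAdversary S σ c mix pf hpf) k ω) =
      Data.ofBits (z u) := by
    rw [hz.corrupted u hu, submittedInput, advInfo_get_three hu]
    rfl
  have e3 : ((advOut S (splitAdversary S σ c mix pf hpf) k ω r C).get 3) = Data.ofList
        [Data.ofFn fun u => if σ u = c then
          Data.ofList [(simulatedOut S u ((stepInput S k ω r C).get 0)
            ((((stepInput S k ω r C).get 0).get 3).get u.val).snd
            (pretendedView σ c (stepInput S k ω r C))).fst] else Data.nil,
          Data.nil,
          Data.ofFn fun u => if σ u = c then
            Data.ofList [(simulatedOut S u ((stepInput S k ω r C).get 0)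
              (submittedInput mix u ((stepInput S k ω r C).get 0))
              (submittingView σ c (stepInput S k ω r C))).fst] else Data.nil] := by
    rw [h.advOut_eq hω]; rfl
  have e4 : ((advOut S (splitAdversary S σ c mix pf hpf) k ω r C).get 2) = Data.nil := by
    rw [h.advOut_eq hω]; rfl
  refine ⟨fun v => ?_, ?_, ?_, ?_⟩
  · rw [sent, if_pos (by simpa using hu), e4]
    simp [partyGet, Data.toList]
  · rw [sent, if_pos (by simpa using hu), e3]
    simp only [partyGet, Data.ofList, Fin.val_zero, Data.get_cons_zero, Data.get_ofFn, if_pos hu,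
      Data.toList, List.map_cons, List.map_nil, h.pretendedView_eq]
    rw [simulatedOut, e1, advInfo_get_three hu]
    rfl
  · rw [sent, if_pos (by simpa using hu), e3]
    simp [partyGet, Data.ofList, Data.toList]
  · rw [sent, if_pos (by simpa using hu), e3]
    have e5 : ((2 : Fin 3) : ℕ) = 2 := rfl
    simp only [partyGet, Data.ofList, e5, Data.get_cons_zero, Data.get_cons_succ, Data.get_ofFn,
      if_pos hu, Data.toList, List.map_cons, List.map_nil, h.submittingView_eq]
    rw [e1, e2, simulatedOut, advInfo_get_three hu]
    rfl

lemma Simulates.net_succ (h : Simulates S σ c mix hpf k ω z r C) (hω : ω.Bounded S k)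
    (w : Party (splitAdversary S σ c mix pf hpf)) (u : Fin n) :
    (nextConf S k ω r C).net (r + 1) w u =
      sent S (splitAdversary S σ c mix pf hpf) k ω r C w u := by
  simp only [nextConf]
  rw [if_pos (h.arrival_eq hω w u).symm, h.future _ (Nat.lt_succ_self r), List.nil_append]

lemma Simulates.record_succ (h : Simulates S σ c mix hpf k ω z r C) (hω : ω.Bounded S k)
    (hz : SubmittedInputs σ c mix ω z) :
    (nextConf S k ω r C).record = splitRecord S σ k (ω.pub, ω.priv) z (r + 1) := by
  simp only [nextConf, splitRecord]
  rw [h.submission_eq hω hz, h.record]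

lemma Simulates.succ (h : Simulates S σ c mix hpf k ω z r C) (hω : ω.Bounded S k)
    (hz : SubmittedInputs σ c mix ω z) :
    Simulates S σ c mix hpf k ω z (r + 1) (nextConf S k ω r C) := by
  have hrec := h.record_succ hω hz
  have hupto : (splitRecord S σ k (ω.pub, ω.priv) z (r + 1)).upto (r + 1) =
      splitRecord S σ k (ω.pub, ω.priv) z (r + 1) := upto_splitRecord _ _ _ _ _ le_rfl
  -- Views of earlier slots are unaffected by the entries appended now, so the invariant may be
  -- stated with the longer record.
  have hview : ∀ (z₁ : Fin n → List Bool) (b : Bool),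
      splitView S σ k (ω.pub, ω.priv) z₁ C.record r b =
      splitView S σ k (ω.pub, ω.priv) z₁ (splitRecord S σ k (ω.pub, ω.priv) z (r + 1)) r b := by
    intro z₁ b
    rw [h.record]
    exact splitView_upto le_rfl (Nat.le_succ r) z b
  have hjoint : jointView S σ k (ω.pub, ω.priv) ω.input C.record r =
      jointView S σ k (ω.pub, ω.priv) ω.input
        (splitRecord S σ k (ω.pub, ω.priv) z (r + 1)) r := by
    rw [h.record]
    exact jointView_upto le_rfl (Nat.le_succ r) z
  have hnet := fun w u => h.net_succ hω w u
  have hstate : (nextConf S k ω r C).state =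
      Data.ofList [splitView S σ k (ω.pub, ω.priv) z C.record r c,
        splitView S σ k (ω.pub, ω.priv) ω.input C.record r c,
        jointView S σ k (ω.pub, ω.priv) ω.input C.record r] := by
    simp only [nextConf]
    rw [h.advOut_eq hω, splitStep, h.submittingView_eq, h.pretendedView_eq, h.observedView_eq]
    rfl
  have hne : ∀ u, σ u = !c ↔ σ u ≠ c := by
    intro u; cases σ u <;> cases c <;> simp
  have hnet0 : ∀ u, (nextConf S k ω r C).net (r + 1) (Sum.inr (0 : Fin 3)) u =
      [castMsg S k (ω.pub, ω.priv) ω.input r u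
        (splitView S σ k (ω.pub, ω.priv) ω.input C.record r (σ u))] := by
    intro u
    rw [hnet]
    by_cases hu : σ u = c
    · rw [(h.sent_corrupted hω hz hu).2.1, hu]
    · exact h.sent_honest _ hu
  have hhonest : ∀ w : Party (splitAdversary S σ c mix pf hpf),
      (∀ u, σ u = c → sent S (splitAdversary S σ c mix pf hpf) k ω r C w u = []) →
      C.view w = splitView S σ k (ω.pub, ω.priv) ω.input C.record r (!c) →
      (nextConf S k ω r C).view w = splitView S σ k (ω.pub, ω.priv) ω.input
        (nextConf S k ω r C).record (r + 1) (!c) := by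
    intro w hw hv
    have e1 : (nextConf S k ω r C).view w = Data.cons (Data.cons
        (inboxData ((nextConf S k ω r C).net (r + 1) w)) (nextConf S k ω r C).record.toData)
        (C.view w) := rfl
    rw [e1, hv, hrec, splitView, hupto]
    simp only [← hview]
    congr 3
    funext u
    rw [hnet]
    by_cases hu : σ u = c
    · rw [hw u hu, if_neg (by rw [hne]; exact not_not.2 hu)]
    · rw [h.sent_honest _ hu, if_pos ((hne u).2 hu)]
  refine ⟨hrec, ?_, ?_, ?_, ?_, ?_, ?_, ?_, ?_, ?_⟩
  · have e1 : (nextConf S k ω r C).view (Sum.inr (0 : Fin 3)) = Data.cons (Data.cons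
        (inboxData ((nextConf S k ω r C).net (r + 1) (Sum.inr (0 : Fin 3))))
        (nextConf S k ω r C).record.toData) (C.view (Sum.inr (0 : Fin 3))) := rfl
    rw [e1, h.joint, hrec, jointView, hupto]
    simp only [← hview, ← hjoint]
    congr 3
    funext u
    exact hnet0 u
  · exact hhonest _ (fun u hu => (h.sent_corrupted hω hz hu).2.2.1) h.side
  · exact fun v hv => hhonest _ (fun u hu => (h.sent_corrupted hω hz hu).1 v) (h.honest v hv)
  · intro t ht w u
    simp only [nextConf]
    rw [if_neg (by rw [h.arrival_eq hω]; omega), h.future t (by omega)]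
  · intro w u
    have hm := eval_mono S.protocol.msgBound (show k + r ≤ k + (r + 1) by omega)
    simp only at hm
    have hcast : ∀ (z₁ : Fin n → List Bool) (view : Data),
        (castMsg S k (ω.pub, ω.priv) z₁ r u view).size ≤
          S.protocol.msgBound.eval (k + (r + 1)) + 1 :=
      fun z₁ view => (size_castMsg_le r u view).trans (by omega)
    rw [hnet]
    by_cases hu : σ u = c
    · obtain ⟨h1, h2, h3, h4⟩ := h.sent_corrupted hω hz hu
      rcases w with v | v
      · exact Or.inl (h1 v)
      · change Fin 3 at v
        fin_cases v
        · exact Or.inr ⟨_, h2, hcast _ _⟩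
        · exact Or.inl h3
        · exact Or.inr ⟨_, h4, hcast _ _⟩
    · exact Or.inr ⟨_, h.sent_honest _ hu, hcast _ _⟩
  · rw [hstate, hrec, splitView, hupto]
    simp only [← hview, Data.ofList, Data.get_cons_zero]
    congr 2
    unfold inboxData
    congr 1
    funext u
    beta_reduce
    by_cases hu : σ u = c
    · rw [if_pos hu, if_pos hu, hnet, (h.sent_corrupted hω hz hu).2.2.2, hu]
    · rw [if_neg hu, if_neg hu, Data.ofList]
  · rw [hstate, hrec, splitView, hupto]
    simp only [← hview, Data.ofList, Data.get_cons_zero, Data.get_cons_succ]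
    congr 2
    unfold inboxData
    congr 1
    funext u
    beta_reduce
    by_cases hu : σ u = c
    · rw [if_pos hu, if_pos hu, hnet0]
    · rw [if_neg hu, if_neg hu, Data.ofList]
  · rw [hstate, hrec, jointView, hupto]
    simp only [← hview, ← hjoint, Data.ofList, Data.get_cons_zero, Data.get_cons_succ]
    congr 3
    funext u
    exact hnet0 u
  · rw [hstate]
    have hm := eval_mono (viewBound S) (show k + r ≤ k + (r + 1) by omega)
    have h1 := size_splitView_le (S := S) (σ := σ) (k := k) (s := (ω.pub, ω.priv)) (z := z) z c
      (le_refl r)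
    have h2 := size_splitView_le (S := S) (σ := σ) (k := k) (s := (ω.pub, ω.priv))
      (z := ω.input) z c (le_refl r)
    have h3 := size_jointView_le (S := S) (σ := σ) (k := k) (s := (ω.pub, ω.priv))
      (z := ω.input) z (le_refl r)
    rw [h.record]
    simp only [Data.ofList, Data.size] at hm ⊢
    omega

end Step

lemma simulates_conf {k : ℕ} {ω : Outcome n} {z : Fin n → List Bool} (hω : ω.Bounded S k)
    (hz : SubmittedInputs σ c mix ω z) (r : ℕ) :
    Simulates S σ c mix hpf k ω z r (conf S (splitAdversary S σ c mix pf hpf) k ω r) := by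
  induction r with
  | zero => exact simulates_zero k ω z
  | succ r ih => rw [conf_succ]; exact ih.succ hω hz

end SplitAdversary

/-! ### Indistinguishable worlds -/

section Worlds

variable {n : ℕ} {S : System n} {σ : Fin n → Bool} {c mix : Bool} {pf : Data → Data}
  {hpf : PolyTime pf} {k : ℕ} {ω : Outcome n} {z : Fin n → List Bool} {r h : ℕ}

lemma conf_record_splitAdversary (hω : ω.Bounded S k) (hz : SubmittedInputs σ c mix ω z) (r : ℕ) :
    (conf S (splitAdversary S σ c mix pf hpf) k ω r).record =
      splitRecord S σ k (ω.pub, ω.priv) z r :=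
  (simulates_conf hω hz r).record

lemma clientView_joint (hω : ω.Bounded S k) (hz : SubmittedInputs σ c mix ω z) (hr : r ≤ h) :
    clientView S (splitAdversary S σ c mix pf hpf) k ω r (0 : Fin 3) =
      jointView S σ k (ω.pub, ω.priv) ω.input (splitRecord S σ k (ω.pub, ω.priv) z h) r := by
  have := (simulates_conf (hpf := hpf) hω hz r).joint
  rw [conf_record_splitAdversary hω hz, jointView_upto le_rfl hr] at this
  exact this

lemma clientView_side (hω : ω.Bounded S k) (hz : SubmittedInputs σ c mix ω z) (hr : r ≤ h) :
    clientView S (splitAdversary S σ c mix pf hpf) k ω r (1 : Fin 3) =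
      splitView S σ k (ω.pub, ω.priv) ω.input (splitRecord S σ k (ω.pub, ω.priv) z h) r (!c) := by
  have := (simulates_conf (hpf := hpf) hω hz r).side
  rw [conf_record_splitAdversary hω hz, splitView_upto le_rfl hr] at this
  exact this

/-- All honest validators have the same view. A simulation of one side therefore yields the complete
table of transcripts that a client would collect. -/
lemma transcript_eq (hω : ω.Bounded S k) (hz : SubmittedInputs σ c mix ω z) (hr : r ≤ h) :
    transcript S (splitAdversary S σ c mix pf hpf) k ω r = fun v => if σ v = !c then
      splitView S σ k (ω.pub, ω.priv) ω.input (splitRecord S σ k (ω.pub, ω.priv) z h) r (!c)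
      else Data.nil := by
  have hs := simulates_conf (hpf := hpf) hω hz r
  funext v
  by_cases hv : σ v = c
  · rw [transcript, if_pos (by simpa using hv), hs.advOut_eq hω, if_neg (by rw [hv]; simp)]
    exact Data.get_nil _
  · have hv' : σ v = !c := by revert hv; cases σ v <;> cases c <;> simp
    have := hs.honest v hv
    rw [conf_record_splitAdversary hω hz, splitView_upto le_rfl hr] at this
    rw [transcript, if_neg (by simpa using hv), if_pos hv', this]

/-- The inputs of the corrupted validators, as the adversary knows them. -/
def knownInputs (σ : Fin n → Bool) (c : Bool) (ω : Outcome n) : Data :=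
  Data.ofFn fun v => if σ v = c then Data.cons (ω.priv v) (Data.ofBits (ω.input v)) else Data.nil

lemma advProof_eq (hω : ω.Bounded S k) (hz : SubmittedInputs σ c mix ω z) (hr : r ≤ h) :
    advProof S (splitAdversary S σ c mix pf hpf) k ω r = pf (Data.ofList
      [Data.ofNat k, ω.pub,
        splitView S σ k (ω.pub, ω.priv) ω.input (splitRecord S σ k (ω.pub, ω.priv) z h) r c,
        jointView S σ k (ω.pub, ω.priv) ω.input (splitRecord S σ k (ω.pub, ω.priv) z h) r,
        knownInputs σ c ω]) := by
  have hs := simulates_conf (hpf := hpf) hω hz r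
  have e1 : (advInfo (splitAdversary S σ c mix pf hpf) k ω).get 3 = knownInputs σ c ω := by
    simp [advInfo, Data.ofList, knownInputs]
  have e2 := hs.pretendedView_eq
  have e3 := hs.observedView_eq
  rw [conf_record_splitAdversary hω hz, splitView_upto le_rfl hr] at e2
  rw [conf_record_splitAdversary hω hz, jointView_upto le_rfl hr] at e3
  rw [advProof, hs.advOut_eq hω, ← e1, ← e2, ← e3]
  rfl

/-- The chain of a client that hears both sides. -/
def jointChain (S : System n) (σ : Fin n → Bool) (k : ℕ) (s : Data × (Fin n → Data))
    (z : Fin n → List Bool) (R : Record n) (r : ℕ) : Data :=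
  S.protocol.client (Data.ofList [Data.ofNat k, s.1, jointView S σ k s z R r])

/-- The chain of a client that hears only side `b`. -/
def sideChain (S : System n) (σ : Fin n → Bool) (k : ℕ) (s : Data × (Fin n → Data))
    (z : Fin n → List Bool) (R : Record n) (r : ℕ) (b : Bool) : Data :=
  S.protocol.client (Data.ofList [Data.ofNat k, s.1, splitView S σ k s z R r b])

/-- The client that hears both sides, or the one that hears only the honest side. -/
def observer : Bool → Fin 3
  | true => 0
  | false => 1

/-! The adversary that corrupts side `c` shows a proof that some client would compute in the world
in which the other side is corrupted: for a safety violation (`none`), or for the missing input of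
a validator, by a client that hears both sides or only side `c`. -/

def transcriptTable (σ : Fin n → Bool) (c : Bool) (view : Data) : Data :=
  Data.ofFn fun v => if σ v = c then view else Data.nil

def fakeProof (S : System n) (Φs Φl : Forensics n) (σ : Fin n → Bool) (c : Bool) :
    Option (Bool × Fin n) → Data → Data
  | none => fun d => Φs.prove (Data.ofList [d.get 0, d.get 1, d.get 2,
      Data.cons (S.protocol.client (Data.ofList [d.get 0, d.get 1, d.get 2]))
        (S.protocol.client (Data.ofList [d.get 0, d.get 1, d.get 3])),
      transcriptTable σ c (d.get 2)])
  | some (joint, v) => fun d => Φl.prove (Data.ofList [d.get 0, d.get 1,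
      if joint = true then d.get 3 else d.get 2,
      -- This is `inputTx` of the input of `v`, which the adversary knows if `v` is on the corrupted
      -- side `c`.
      Data.cons (Data.ofNat v.val) ((d.get 4).get v.val).snd,
      transcriptTable σ c (d.get 2)])

lemma polyTime_transcriptTable {f : Data → Data} (hf : PolyTime f) :
    PolyTime fun d => transcriptTable σ c (f d) :=
  PolyTime.ofFn fun _ => hf.ite PolyTime.nil

lemma polyTime_fakeProof (S : System n) (Φs Φl : Forensics n) (σ : Fin n → Bool) (c : Bool)
    (e : Option (Bool × Fin n)) : PolyTime (fakeProof S Φs Φl σ c e) := by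
  have h : ∀ i, PolyTime fun d => d.get i := fun i => PolyTime.id.get i
  have ht : PolyTime fun d => transcriptTable σ c (d.get 2) := polyTime_transcriptTable (h 2)
  have hc : ∀ i, PolyTime fun d =>
      S.protocol.client (Data.ofList [d.get 0, d.get 1, d.get i]) := fun i =>
    S.protocol.client_polyTime.comp ((h 0).ofList_cons ((h 1).ofList_cons ((h i).ofList_cons
      PolyTime.ofList_nil)))
  match e with
  | none => exact Φs.prove_polyTime.comp ((h 0).ofList_cons ((h 1).ofList_cons ((h 2).ofList_cons
      (((hc 2).cons (hc 3)).ofList_cons (ht.ofList_cons PolyTime.ofList_nil)))))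
  | some (joint, v) => exact Φl.prove_polyTime.comp ((h 0).ofList_cons ((h 1).ofList_cons
      (((h 3).ite (h 2)).ofList_cons (((PolyTime.const _).cons ((h 4).get v.val).snd).ofList_cons
        (ht.ofList_cons PolyTime.ofList_nil)))))

/-- The adversary that corrupts side `c` and shows a fake proof. -/
noncomputable def framingAdversary (S : System n) (Φs Φl : Forensics n) (σ : Fin n → Bool)
    (c mix : Bool) (e : Option (Bool × Fin n)) : Adversary n :=
  splitAdversary S σ c mix (fakeProof S Φs Φl σ c e) (polyTime_fakeProof S Φs Φl σ c e)

/-- The executions in which accountability fails. -/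
def Unaccountable (S : System n) (Φs Φl : Forensics n) (fs fa T : ℕ) (A : Adversary n) (k : ℕ)
    (ω : Outcome n) (h : ℕ) : Prop :=
  (UnaccountedSafetyViolation S Φs A k ω fs h ∨ Framed S Φs A k ω h) ∨
    (UnaccountedLivenessViolation S Φl A k ω T fa h ∨ Framed S Φl A k ω h)

/-! ### Carrying a proof of guilt over to the other world -/

variable {Φ Φs Φl : Forensics n}

section Pair

variable {mix' : Bool} {pf' : Data → Data} {hpf' : PolyTime pf'} {ω' : Outcome n}
  {z' : Fin n → List Bool}

/-- A proof that identifies a validator of side `c` frames it in the world where side `c` is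
honest. -/
lemma framed_of_accounts (hω : ω.Bounded S k) (hz : SubmittedInputs σ c mix ω z)
    (hω' : ω'.Bounded S k) (hz' : SubmittedInputs σ (!c) mix' ω' z')
    (hpub : ω'.pub = ω.pub) (hpriv : ω'.priv = ω.priv) (hinput : ω'.input = ω.input)
    (hR : splitRecord S σ k (ω.pub, ω.priv) z h = splitRecord S σ k (ω.pub, ω.priv) z' h)
    {f : ℕ} (hf : 0 < f) {r₀ : ℕ} (hr : r₀ + Φ.delay.eval k ≤ h)
    {cl : Fin (splitAdversary S σ c mix pf hpf).clients} {ev : Data}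
    (hacc : Accounts S Φ (splitAdversary S σ c mix pf hpf) k ω f r₀ cl ev)
    (hproof : advProof S (splitAdversary S σ (!c) mix' pf' hpf') k ω' r₀ =
      clientProof S Φ (splitAdversary S σ c mix pf hpf) k ω r₀ cl ev) :
    Framed S Φ (splitAdversary S σ (!c) mix' pf' hpf') k ω' h := by
  refine ⟨(0 : Fin 3), r₀, r₀ + Φ.delay.eval k, Nat.le_add_right _ _, hr, Nat.zero_le _, ?_⟩
  obtain ⟨h1, h2⟩ := hacc (0 : Fin 3) (Nat.zero_le _)
  intro hsub
  -- Client `0` has the same view in both worlds, so the same proof makes it identify the same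
  -- validators.
  have e : identified S Φ (splitAdversary S σ (!c) mix' pf' hpf') k ω' (r₀ + Φ.delay.eval k)
      (0 : Fin 3) (advProof S (splitAdversary S σ (!c) mix' pf' hpf') k ω' r₀) =
      identified S Φ (splitAdversary S σ c mix pf hpf) k ω (r₀ + Φ.delay.eval k) (0 : Fin 3)
        (clientProof S Φ (splitAdversary S σ c mix pf hpf) k ω r₀ cl ev) := by
    unfold identified
    rw [hproof, clientView_joint hω hz hr, clientView_joint hω' hz' hr, hpub, hpriv, hinput, hR]
  rw [e] at hsub
  obtain ⟨v, hv⟩ := Finset.card_pos.1 (hf.trans_le h1)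
  rw [Finset.mem_inter] at hv
  have h3 := hsub hv.1
  have h4 := hv.2
  rw [mem_corrupted_splitAdversary] at h3 h4
  rw [h4] at h3
  cases c <;> simp at h3

/-- A missing input or incomparable chains would be accounted for by a validator of side `c`. In the
other world the adversary reproduces that proof: its pretended copy has the view of client `1`, and
it also observes the view of client `0`. There side `c` is honest and gets framed. -/
lemma honest_side_consistent {fs fa T : ℕ} (hfs : 0 < fs) (hfa : 0 < fa)
    (hω : ω.Bounded S k) (hz : SubmittedInputs σ c mix ω z)
    (hω' : ω'.Bounded S k) (hz' : SubmittedInputs σ (!c) mix' ω' z')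
    (hpub : ω'.pub = ω.pub) (hpriv : ω'.priv = ω.priv) (hinput : ω'.input = ω.input)
    (hR : splitRecord S σ k (ω.pub, ω.priv) z h = splitRecord S σ k (ω.pub, ω.priv) z' h)
    {r₀ : ℕ} (hT : T ≤ r₀) (hs : r₀ + Φs.delay.eval k ≤ h) (hl : r₀ + Φl.delay.eval k ≤ h)
    (hgood : ∀ e, ¬ Unaccountable S Φs Φl fs fa T (framingAdversary S Φs Φl σ c mix e) k ω h)
    (hgood' : ∀ e,
      ¬ Unaccountable S Φs Φl fs fa T (framingAdversary S Φs Φl σ (!c) mix' e) k ω' h) :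
    (∀ v, σ v = !c →
      inputTx v (ω.input v) ∈ txsOf (jointChain S σ k (ω.pub, ω.priv) ω.input
        (splitRecord S σ k (ω.pub, ω.priv) z h) r₀).toList ∧
      inputTx v (ω.input v) ∈ txsOf (sideChain S σ k (ω.pub, ω.priv) ω.input
        (splitRecord S σ k (ω.pub, ω.priv) z h) r₀ (!c)).toList) ∧
    ((sideChain S σ k (ω.pub, ω.priv) ω.input
        (splitRecord S σ k (ω.pub, ω.priv) z h) r₀ (!c)).toList <+:
      (jointChain S σ k (ω.pub, ω.priv) ω.input
        (splitRecord S σ k (ω.pub, ω.priv) z h) r₀).toList ∨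
     (jointChain S σ k (ω.pub, ω.priv) ω.input
        (splitRecord S σ k (ω.pub, ω.priv) z h) r₀).toList <+:
      (sideChain S σ k (ω.pub, ω.priv) ω.input
        (splitRecord S σ k (ω.pub, ω.priv) z h) r₀ (!c)).toList) := by
  have hr₀ : r₀ ≤ h := by omega
  have hjoint : ∀ e, chainData S (framingAdversary S Φs Φl σ c mix e) k ω r₀ (0 : Fin 3) =
      jointChain S σ k (ω.pub, ω.priv) ω.input (splitRecord S σ k (ω.pub, ω.priv) z h) r₀ := by
    intro e
    unfold chainData framingAdversary
    rw [clientView_joint hω hz hr₀]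
    rfl
  have hside : ∀ e, chainData S (framingAdversary S Φs Φl σ c mix e) k ω r₀ (1 : Fin 3) =
      sideChain S σ k (ω.pub, ω.priv) ω.input
        (splitRecord S σ k (ω.pub, ω.priv) z h) r₀ (!c) := by
    intro e
    unfold chainData framingAdversary
    rw [clientView_side hω hz hr₀]
    rfl
  have hknown : ∀ v, σ v = !c → ((knownInputs σ (!c) ω').get v.val).snd =
      Data.ofBits (ω.input v) := by
    intro v hv
    rw [knownInputs, Data.get_ofFn, if_pos hv, hinput]
    rfl
  have hlive : ∀ (joint : Bool) (v : Fin n), σ v = !c →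
      inputTx v (ω.input v) ∈ txsOf (chain S
        (framingAdversary S Φs Φl σ c mix (some (joint, v))) k ω r₀
          (observer joint)) := by
    intro joint v hv
    by_contra hmiss
    have hacc : Accounts S Φl (framingAdversary S Φs Φl σ c mix (some (joint, v))) k ω fa r₀
        (observer joint) (inputTx v (ω.input v)) := by
      by_contra hacc
      refine hgood (some (joint, v)) (Or.inr (Or.inl ⟨v, _, r₀, hr₀, ⟨?_, ?_, hT, hmiss⟩, hacc⟩))
      · unfold framingAdversary
        rw [mem_corrupted_splitAdversary, hv]
        cases c <;> simp
      · exact Nat.zero_le _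
    refine hgood' (some (joint, v)) (Or.inr (Or.inr ?_))
    refine framed_of_accounts hω hz hω' hz' hpub hpriv hinput hR hfa hl hacc ?_
    rw [advProof_eq hω' hz' hr₀]
    unfold clientProof
    have hview : clientView S (splitAdversary S σ c mix _
        (polyTime_fakeProof S Φs Φl σ c (some (joint, v)))) k ω r₀
          (observer joint) =
        if joint = true then jointView S σ k (ω.pub, ω.priv) ω.input
          (splitRecord S σ k (ω.pub, ω.priv) z h) r₀
        else splitView S σ k (ω.pub, ω.priv) ω.input
          (splitRecord S σ k (ω.pub, ω.priv) z h) r₀ (!c) := by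
      cases joint
      · exact clientView_side hω hz hr₀
      · exact clientView_joint hω hz hr₀
    rw [hview, transcript_eq hω hz hr₀]
    simp only [fakeProof, Data.ofList, Data.get_cons_succ, Data.get_cons_zero, hknown v hv]
    rw [hpub, hpriv, hinput, ← hR]
    rfl
  refine ⟨fun v hv => ⟨?_, ?_⟩, ?_⟩
  · have := hlive true v hv
    rw [← hjoint (some (true, v))]
    exact this
  · have := hlive false v hv
    rw [← hside (some (false, v))]
    exact this
  · by_contra hcon
    push Not at hcon
    have hviol : SafetyViolation S (framingAdversary S Φs Φl σ c mix none) k ω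
        (1 : Fin 3) (0 : Fin 3) r₀ r₀ := by
      refine ⟨Nat.zero_le _, Nat.zero_le _, Or.inl ?_⟩
      unfold chain
      rw [hjoint, hside]
      exact hcon
    have hacc : Accounts S Φs (framingAdversary S Φs Φl σ c mix none) k ω fs r₀ (1 : Fin 3)
        (Data.cons (chainData S (framingAdversary S Φs Φl σ c mix none) k ω r₀ (1 : Fin 3))
          (chainData S (framingAdversary S Φs Φl σ c mix none) k ω r₀ (0 : Fin 3))) := by
      by_contra hacc
      refine hgood none (Or.inl (Or.inl ⟨_, _, r₀, r₀, hr₀, hr₀, hviol, fun hboth => ?_⟩))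
      rw [max_self] at hboth
      exact hacc hboth.1
    rw [hjoint, hside] at hacc
    refine hgood' none (Or.inl (Or.inr ?_))
    refine framed_of_accounts hω hz hω' hz' hpub hpriv hinput hR hfs hs hacc ?_
    rw [advProof_eq hω' hz' hr₀]
    unfold clientProof
    rw [clientView_side hω hz hr₀, transcript_eq hω hz hr₀]
    simp only [fakeProof, Data.ofList, Data.get_cons_succ, Data.get_cons_zero]
    rw [hpub, hpriv, hinput, ← hR]
    rfl

end Pair

end Worlds

/-! ### Valid chains -/

section Valid

variable {n : ℕ} {S : System n}

lemma ValidTxs.of_append {valid : List Data → Data → Prop} {l l' : List Data}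
    (h : ValidTxs valid (l ++ l')) : ValidTxs valid l := by
  intro pre tx post e
  exact h pre tx (post ++ l') (by rw [e]; simp)

lemma txsOf_mono {l l' : List Data} (h : l <+: l') {tx : Data} (htx : tx ∈ txsOf l) :
    tx ∈ txsOf l' := by
  obtain ⟨t, rfl⟩ := h
  simp only [txsOf, List.flatMap_append, List.mem_append]
  exact Or.inl htx

/-- A valid list contains at most one input of each validator. -/
lemma ValidTxs.input_unique (hvalid : S.InputsValid) {k : ℕ} {l : List Data}
    (hl : ValidTxs (S.protocol.valid k) l) {v : Fin n} {s s' : List Bool}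
    (hs : s.length = S.m.eval k) (hs' : s'.length = S.m.eval k)
    (h : inputTx v s ∈ l) (h' : inputTx v s' ∈ l) : s = s' := by
  -- For two occurrences at different positions, validity of the later one relative to a prefix
  -- containing the earlier one forces equality.
  have key : ∀ (s s' : List Bool) (pre mid post : List Data), s.length = S.m.eval k →
      s'.length = S.m.eval k → l = pre ++ inputTx v s :: (mid ++ inputTx v s' :: post) → s = s' := by
    intro s s' pre mid post hs hs' e
    have e' : l = (pre ++ inputTx v s :: mid) ++ inputTx v s' :: post := by rw [e]; simp
    refine (hvalid k (pre ++ inputTx v s :: mid) v s' ?_ hs').2 (hl _ _ _ e') s hs (by simp)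
    rw [e'] at hl
    exact hl.of_append
  obtain ⟨pre, post, rfl⟩ := List.append_of_mem h
  rw [List.mem_append, List.mem_cons] at h'
  rcases h' with h' | h' | h'
  · obtain ⟨pre', post', rfl⟩ := List.append_of_mem h'
    exact (key s' s pre' post' post hs' hs (by simp)).symm
  · by_contra hne
    have : s' = s := by
      have e : Data.ofBits s' = Data.ofBits s := (Data.cons.inj h').2
      rw [← Data.toBits_ofBits s', e, Data.toBits_ofBits]
    exact hne this.symm
  · obtain ⟨pre', post', rfl⟩ := List.append_of_mem h'
    exact key s s' pre pre' post' hs hs' rfl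

end Valid

/-! ### Random inputs -/

section Random

variable {n : ℕ} (S : System n)

/-- The inputs of all validators. -/
abbrev Inputs (k : ℕ) : Type := Fin n → Fin (S.m.eval k) → Bool

/-- The environment that gives each validator an independent uniformly distributed input. -/
noncomputable def uniformEnvironment : Environment where
  tapeLen := S.m * Polynomial.C n
  sample := fun d => d.get 1
  sample_polyTime := PolyTime.id.get 1

/-- Coins of the environment, as inputs. -/
noncomputable def coinsEquivInputs (k : ℕ) :
    (Fin ((S.m * Polynomial.C n).eval k) → Bool) ≃ Inputs S k :=
  (Equiv.arrowCongr ((finCongr (by simp [mul_comm])).trans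
    (finProdFinEquiv (m := n) (n := S.m.eval k)).symm) (Equiv.refl Bool)).trans
      (Equiv.curry _ _ _)

lemma uniformEnvironment_input (k : ℕ) (t : Fin ((S.m * Polynomial.C n).eval k) → Bool)
    (v : Fin n) : (uniformEnvironment S).input (S.m.eval k) k (List.ofFn t) v.val =
      List.ofFn (coinsEquivInputs S k t v) := by
  unfold Environment.input
  congr 1
  funext j
  have e : ((uniformEnvironment S).sample
      (Data.ofList [Data.ofNat k, Data.ofBits (List.ofFn t)])).toBits = List.ofFn t :=
    Data.toBits_ofBits _
  have hlt : v.val * S.m.eval k + j.val < (S.m * Polynomial.C n).eval k := by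
    have h1 : (v.val + 1) * S.m.eval k ≤ n * S.m.eval k := Nat.mul_le_mul_right _ v.2
    have h2 := j.2
    rw [add_mul, one_mul] at h1
    rw [Polynomial.eval_mul, Polynomial.eval_C, mul_comm (S.m.eval k) n]
    omega
  rw [e, List.getD_eq_getElem _ _ (by simpa using hlt), List.getElem_ofFn]
  simp only [coinsEquivInputs, Equiv.trans_apply, Equiv.curry_apply, Function.curry,
    Equiv.arrowCongr_apply, Function.comp, Equiv.refl_apply, Equiv.symm_trans_apply,
    Equiv.symm_symm]
  congr 1
  ext
  simp [mul_comm, add_comm]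

/-- Coins of the adversary, as inputs. -/
noncomputable def tapeEquivInputs (k : ℕ) :
    (Fin ((S.m * Polynomial.C n).eval k) → Bool) ≃ Inputs S k :=
  (Equiv.arrowCongr ((((finCongr (by simp)).trans
    (finProdFinEquiv (m := S.m.eval k) (n := n)).symm).trans
      -- The reversal compensates for `slice`, which returns the last entry first.
      (Equiv.prodComm _ _)).trans (Equiv.prodCongr (Equiv.refl _) Fin.revPerm))
        (Equiv.refl Bool)).trans (Equiv.curry _ _ _)

lemma slice_tape (k : ℕ) (t : Fin ((S.m * Polynomial.C n).eval k) → Bool) (v : Fin n) :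
    slice n v.val (Data.ofBits (List.ofFn t)) =
      Data.ofBits (List.ofFn (tapeEquivInputs S k t v)) := by
  have hlen : (S.m * Polynomial.C n).eval k = S.m.eval k * n := by simp
  have h := slice_ofBits v (S.m.eval k)
    fun j i => t ((finCongr hlen).symm (finProdFinEquiv (j, i)))
  simp only [Prod.mk.eta, Equiv.apply_symm_apply] at h
  have e : (List.ofFn fun p : Fin (S.m.eval k * n) => t ((finCongr hlen).symm p)) =
      List.ofFn t := by
    apply List.ext_getElem
    · simp
    · intro i h1 h2
      simp
  rw [e] at h
  rw [h]
  congr 1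
  apply List.ext_getElem
  · simp
  · intro i h1 h2
    rw [List.getElem_reverse, List.getElem_ofFn, List.getElem_ofFn]
    simp only [tapeEquivInputs, Equiv.trans_apply, Equiv.curry_apply, Function.curry,
      Equiv.arrowCongr_apply, Function.comp, Equiv.refl_apply, Equiv.symm_trans_apply]
    congr 3
    ext
    · simp [Fin.val_rev]
      omega
    · rfl

/-- The outcome with given setup, inputs and coins of the adversary. -/
noncomputable def outcomeOf (k : ℕ) (s : Data × (Fin n → Data)) (z w : Inputs S k) : Outcome n :=
  ⟨s.1, s.2, fun v => List.ofFn (z v), List.ofFn ((tapeEquivInputs S k).symm w)⟩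

lemma bounded_outcomeOf {k : ℕ} {s : Data × (Fin n → Data)}
    (hs : s ∈ (S.protocol.setup k).support) (z w : Inputs S k) :
    (outcomeOf S k s z w).Bounded S k := by
  have h := S.protocol.setup_bound.choose_spec k s hs
  refine ⟨h.1, h.2, fun v => ?_, ?_⟩ <;> simp [outcomeOf]

/-- The inputs used for the record when side `c` is corrupted. -/
def recordInputs (σ : Fin n → Bool) (c mix : Bool) {k : ℕ} (z w : Inputs S k) : Inputs S k :=
  fun u => if σ u = c ∧ mix = true then w u else z u

lemma submittedInputs_outcomeOf (σ : Fin n → Bool) (c mix : Bool) {k : ℕ}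
    (s : Data × (Fin n → Data)) (z w : Inputs S k) :
    SubmittedInputs σ c mix (outcomeOf S k s z w)
      fun u => List.ofFn (recordInputs S σ c mix z w u) := by
  refine ⟨fun u hu => ?_, fun u hu => ?_⟩
  · simp [recordInputs, outcomeOf, hu]
  · by_cases hm : mix = true
    · simp only [recordInputs, outcomeOf, hu, hm, if_true, and_self]
      rw [slice_tape, Equiv.apply_symm_apply]
    · simp [recordInputs, outcomeOf, hm]

open Classical in
/-- The number of inputs and coins for which an outcome with setup `s` is in `E`. -/
noncomputable def outcomeCount (k : ℕ) (s : Data × (Fin n → Data)) (E : Set (Outcome n)) : ℕ :=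
  (Finset.univ.filter fun p : Inputs S k × Inputs S k => outcomeOf S k s p.1 p.2 ∈ E).card

-- Both choices are uniform and are carried to `γ` by bijections, so the probability is the
-- proportion of pairs in `γ × γ` that lead to `E`.
open Classical in
lemma toOuterMeasure_uniform_bind_map {α β γ δ : Type*} [Fintype α] [Nonempty α] [Fintype β]
    [Nonempty β] [Fintype γ] (eα : α ≃ γ) (eβ : β ≃ γ) (g : γ → γ → δ) (E : Set δ) :
    ((PMF.uniformOfFintype α).bind fun a =>
      (PMF.uniformOfFintype β).map fun b => g (eα a) (eβ b)).toOuterMeasure E =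
      ((Finset.univ.filter fun p : γ × γ => g p.1 p.2 ∈ E).card : ENNReal) /
        ((Fintype.card γ : ENNReal) * Fintype.card γ) := by
  have hα := Fintype.card_congr eα
  have hβ := Fintype.card_congr eβ
  have hγ : (Fintype.card γ : ENNReal) ≠ 0 := by
    rw [← hα]; exact_mod_cast Fintype.card_ne_zero
  have hinv : ∀ x : ENNReal, (Fintype.card γ : ENNReal)⁻¹ * (x / Fintype.card γ) =
      x / ((Fintype.card γ : ENNReal) * Fintype.card γ) := by
    intro x
    rw [div_eq_mul_inv, div_eq_mul_inv,
      ENNReal.mul_inv (Or.inl hγ) (Or.inl (ENNReal.natCast_ne_top _))]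
    ring
  rw [PMF.toOuterMeasure_bind_apply, tsum_fintype]
  have hterm : ∀ a, (PMF.uniformOfFintype α) a *
      ((PMF.uniformOfFintype β).map fun b => g (eα a) (eβ b)).toOuterMeasure E =
      ((Finset.univ.filter fun y : γ => g (eα a) y ∈ E).card : ENNReal) /
        ((Fintype.card γ : ENNReal) * Fintype.card γ) := by
    intro a
    rw [PMF.toOuterMeasure_map_apply, PMF.uniformOfFintype_apply,
      PMF.toOuterMeasure_uniformOfFintype_apply, hα, hβ, hinv, Fintype.card_subtype]
    · congr 2
      refine Finset.card_bij (fun b _ => eβ b) ?_ ?_ ?_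
      · intro b hb; simpa using hb
      · intro b _ b' _ h; exact eβ.injective h
      · intro y hy; exact ⟨eβ.symm y, by simpa using hy, by simp⟩
  rw [Finset.sum_congr rfl fun a _ => hterm a]
  simp only [div_eq_mul_inv]
  rw [← Finset.sum_mul]
  congr 1
  rw [← Nat.cast_sum, Equiv.sum_comp eα fun x =>
    (Finset.univ.filter fun y : γ => g x y ∈ E).card]
  congr 1
  rw [← Finset.card_sigma]
  refine Finset.card_bij (fun p _ => (p.1, p.2)) ?_ ?_ ?_
  · rintro ⟨x, y⟩ h; simpa using h
  · rintro ⟨x, y⟩ _ ⟨x', y'⟩ _ h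
    simp only [Prod.mk.injEq] at h
    obtain ⟨rfl, rfl⟩ := h
    rfl
  · rintro ⟨x, y⟩ h; exact ⟨⟨x, y⟩, by simpa using h, rfl⟩

/-- All adversaries with this tape length share one space of inputs and coins. For a fixed setup
their failures can be counted together. -/
lemma toOuterMeasure_outcome {A : Adversary n} (hA : A.tapeLen = S.m * Polynomial.C n) (k : ℕ)
    (E : Set (Outcome n)) :
    (S.outcome (uniformEnvironment S) A k).toOuterMeasure E =
      ∑' s, S.protocol.setup k s * ((outcomeCount S k s E : ENNReal) /
        ((Fintype.card (Inputs S k) : ENNReal) * Fintype.card (Inputs S k))) := by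
  obtain ⟨corrupted, clients, join, tapeLen, bound, step, step_polyTime⟩ := A
  obtain rfl : tapeLen = S.m * Polynomial.C n := hA
  rw [System.outcome, PMF.toOuterMeasure_bind_apply]
  refine tsum_congr fun s => ?_
  congr 1
  have := toOuterMeasure_uniform_bind_map (coinsEquivInputs S k) (tapeEquivInputs S k)
    (outcomeOf S k s) E
  rw [outcomeCount, ← this]
  have e : ∀ (t a : Fin ((S.m * Polynomial.C n).eval k) → Bool),
      (⟨s.1, s.2, fun v => (uniformEnvironment S).input (S.m.eval k) k (List.ofFn t) v.val,
        List.ofFn a⟩ : Outcome n) =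
      outcomeOf S k s (coinsEquivInputs S k t) (tapeEquivInputs S k a) := by
    intro t a
    simp only [outcomeOf, uniformEnvironment_input, Equiv.symm_apply_apply]
  simp only [← e]
  rfl

/-- If finitely many events are improbable, then for some setup all of them are. -/
lemma exists_setup_of_prob_lt {ι : Type*} [Fintype ι] (A : ι → Adversary n)
    (hA : ∀ i, (A i).tapeLen = S.m * Polynomial.C n) (k : ℕ) (E : ι → Set (Outcome n))
    (h : ∑ i, S.prob (uniformEnvironment S) (A i) k (E i) < 1 / 100) :
    ∃ s ∈ (S.protocol.setup k).support, 100 * ∑ i, outcomeCount S k s (E i) ≤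
      Fintype.card (Inputs S k) * Fintype.card (Inputs S k) := by
  by_contra! hcon
  set K := Fintype.card (Inputs S k) with hK
  have hKpos : 0 < K := Fintype.card_pos
  have hfin : ∀ i, (S.outcome (uniformEnvironment S) (A i) k).toOuterMeasure (E i) ≠ ⊤ := by
    intro i
    refine ne_top_of_le_ne_top ENNReal.one_ne_top ?_
    refine (MeasureTheory.measure_mono (Set.subset_univ _)).trans_eq ?_
    exact (PMF.toOuterMeasure_apply_eq_one_iff _ _).2 (Set.subset_univ _)
  have h1 : ∑ i, S.prob (uniformEnvironment S) (A i) k (E i) =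
      (∑ i, (S.outcome (uniformEnvironment S) (A i) k).toOuterMeasure (E i)).toReal := by
    rw [ENNReal.toReal_sum fun i _ => hfin i]
    rfl
  -- The conditional probabilities, summed over the events, exceed `1/100` for every setup in the
  -- support; their average is then at least `1/100`.
  have h2 : (100 : ENNReal)⁻¹ ≤
      ∑ i, (S.outcome (uniformEnvironment S) (A i) k).toOuterMeasure (E i) := by
    simp only [toOuterMeasure_outcome S (hA _)]
    rw [← Summable.tsum_finsetSum fun i _ => ENNReal.summable]
    calc (100 : ENNReal)⁻¹ = ∑' s, S.protocol.setup k s * (100 : ENNReal)⁻¹ := by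
          rw [ENNReal.tsum_mul_right, PMF.tsum_coe, one_mul]
      _ ≤ _ := by
          refine ENNReal.tsum_le_tsum fun s => ?_
          rw [← Finset.mul_sum]
          by_cases hs : s ∈ (S.protocol.setup k).support
          · gcongr
            have h3 := hcon s hs
            simp only [div_eq_mul_inv]
            rw [← Finset.sum_mul, ← Nat.cast_sum, ← div_eq_mul_inv,
              ENNReal.le_div_iff_mul_le]
            · rw [mul_comm, ← div_eq_mul_inv]
              refine ENNReal.div_le_of_le_mul ?_
              have h4 : K * K ≤ (∑ i, outcomeCount S k s (E i)) * 100 := by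
                rw [mul_comm _ 100]
                exact h3.le
              exact_mod_cast h4
            · left
              exact_mod_cast (Nat.mul_pos hKpos hKpos).ne'
            · left
              exact ENNReal.mul_ne_top (ENNReal.natCast_ne_top _) (ENNReal.natCast_ne_top _)
          · rw [PMF.mem_support_iff, not_not] at hs
            simp [hs]
  have h4 : ((100 : ENNReal)⁻¹).toReal ≤
      (∑ i, (S.outcome (uniformEnvironment S) (A i) k).toOuterMeasure (E i)).toReal :=
    ENNReal.toReal_mono (ENNReal.sum_ne_top.2 fun i _ => hfin i) h2
  rw [← h1] at h4
  norm_num at h4 h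
  linarith

end Random

/-! ### Many executions go wrong -/

section Main

variable {n : ℕ} {S : System n} {σ : Fin n → Bool} {Φs Φl : Forensics n} {k fs fa T r₀ h : ℕ}
  {s : Data × (Fin n → Data)}

/-- The inputs of all validators, from those of the two sides. -/
def glue (S : System n) (σ : Fin n → Bool) (k : ℕ) :
    Inputs S k ≃ ({u // σ u = true} → Fin (S.m.eval k) → Bool) ×
      ({u // ¬ σ u = true} → Fin (S.m.eval k) → Bool) :=
  Equiv.piEquivPiSubtypeProd (fun u => σ u = true) _

lemma glue_symm_of_true {x : {u // σ u = true} → Fin (S.m.eval k) → Bool}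
    {y : {u // ¬ σ u = true} → Fin (S.m.eval k) → Bool} {u : Fin n} (hu : σ u = true) :
    (glue S σ k).symm (x, y) u = x ⟨u, hu⟩ := by
  simp [glue, Equiv.piEquivPiSubtypeProd, hu]

lemma glue_symm_of_false {x : {u // σ u = true} → Fin (S.m.eval k) → Bool}
    {y : {u // ¬ σ u = true} → Fin (S.m.eval k) → Bool} {u : Fin n} (hu : ¬ σ u = true) :
    (glue S σ k).symm (x, y) u = y ⟨u, hu⟩ := by
  simp [glue, Equiv.piEquivPiSubtypeProd, hu]

/-- Inputs as bit strings. -/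
def bits {k : ℕ} (z : Inputs S k) (u : Fin n) : List Bool := List.ofFn (z u)

/-- The chains of clients that hear both sides, or one of them, fit together. -/
structure Consistent (S : System n) (σ : Fin n → Bool) (k : ℕ) (s : Data × (Fin n → Data))
    (z : Fin n → List Bool) (R : Record n) (r : ℕ) : Prop where
  joint : ∀ v, inputTx v (z v) ∈ txsOf (jointChain S σ k s z R r).toList
  side : ∀ v, inputTx v (z v) ∈ txsOf (sideChain S σ k s z R r (σ v)).toList
  comparable : ∀ b, (sideChain S σ k s z R r b).toList <+: (jointChain S σ k s z R r).toList ∨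
    (jointChain S σ k s z R r).toList <+: (sideChain S σ k s z R r b).toList

/-- The two worlds share inputs and record; only the coins may differ. Applying
`honest_side_consistent` in both directions covers both sides. -/
lemma consistent_of_accountable (hfs : 0 < fs) (hfa : 0 < fa)
    (hs : s ∈ (S.protocol.setup k).support) (hT : T ≤ r₀)
    (hds : r₀ + Φs.delay.eval k ≤ h) (hdl : r₀ + Φl.delay.eval k ≤ h)
    {mix : Bool} {z w w' : Inputs S k}
    (hR : splitRecord S σ k s (bits (recordInputs S σ false mix z w)) h =
      splitRecord S σ k s (bits (recordInputs S σ true mix z w')) h)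
    (hgood : ∀ e, ¬ Unaccountable S Φs Φl fs fa T (framingAdversary S Φs Φl σ false mix e) k
      (outcomeOf S k s z w) h)
    (hgood' : ∀ e, ¬ Unaccountable S Φs Φl fs fa T (framingAdversary S Φs Φl σ true mix e) k
      (outcomeOf S k s z w') h) :
    Consistent S σ k s (bits z)
      (splitRecord S σ k s (bits (recordInputs S σ false mix z w)) h) r₀ := by
  have h1 := honest_side_consistent (c := false) hfs hfa (bounded_outcomeOf S hs z w)
    (submittedInputs_outcomeOf S σ false mix s z w) (bounded_outcomeOf S hs z w')
    (submittedInputs_outcomeOf S σ true mix s z w') rfl rfl rfl hR hT hds hdl hgood hgood'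
  have h2 := honest_side_consistent (c := true) hfs hfa (bounded_outcomeOf S hs z w')
    (submittedInputs_outcomeOf S σ true mix s z w') (bounded_outcomeOf S hs z w)
    (submittedInputs_outcomeOf S σ false mix s z w) rfl rfl rfl hR.symm hT hds hdl hgood' hgood
  have e1 : splitRecord S σ k ((outcomeOf S k s z w).pub, (outcomeOf S k s z w).priv)
    (fun u => List.ofFn (recordInputs S σ false mix z w u)) h =
    splitRecord S σ k s (bits (recordInputs S σ false mix z w)) h := rfl
  have e2 : splitRecord S σ k ((outcomeOf S k s z w').pub, (outcomeOf S k s z w').priv)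
    (fun u => List.ofFn (recordInputs S σ true mix z w' u)) h =
    splitRecord S σ k s (bits (recordInputs S σ false mix z w)) h := hR.symm
  rw [e1] at h1
  rw [e2] at h2
  refine ⟨fun v => ?_, fun v => ?_, fun b => ?_⟩
  · cases hv : σ v
    · exact (h2.1 v hv).1
    · exact (h1.1 v hv).1
  · cases hv : σ v
    · exact (h2.1 v hv).2
    · exact (h1.1 v hv).2
  · cases b
    · exact h2.2
    · exact h1.2

lemma sideChain_congr {z z' : Fin n → List Bool} {b : Bool} (hz : ∀ u, σ u = b → z u = z' u)
    (R : Record n) (r : ℕ) : sideChain S σ k s z R r b = sideChain S σ k s z' R r b := by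
  rw [sideChain, splitView_congr_input hz, sideChain]

lemma ofFn_eq_of_mem_chain (hvalid : S.InputsValid) {pub view : Data} {v : Fin n}
    {a b : Fin (S.m.eval k) → Bool}
    (ha : inputTx v (List.ofFn a) ∈
      txsOf (S.protocol.client (Data.ofList [Data.ofNat k, pub, view])).toList)
    (hb : inputTx v (List.ofFn b) ∈
      txsOf (S.protocol.client (Data.ofList [Data.ofNat k, pub, view])).toList) : a = b :=
  List.ofFn_injective ((S.protocol.client_valid k pub view).input_unique hvalid
    (List.length_ofFn) (List.length_ofFn) ha hb)

open Classical in
/-- With limited data, some inputs and coins lead to an execution without accountability. -/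
lemma card_inputs_lt_outcomeCount (hvalid : S.InputsValid) (hfs : 0 < fs) (hfa : 0 < fa)
    (hs : s ∈ (S.protocol.setup k).support) (hT : T ≤ r₀)
    (hds : r₀ + Φs.delay.eval k ≤ h) (hdl : r₀ + Φl.delay.eval k ≤ h)
    (hbits : ∀ (subs : ℕ → Fin n → Data) (r : ℕ),
      (((S.service k).encode ((S.service k).record subs r)).length : ℤ) <
        ((S.m.eval k : ℕ) : ℤ) * ((n / 2 : ℕ) : ℤ) - 1)
    (hσ : Fintype.card {u // σ u = true} = n / 2) :
    Fintype.card (Inputs S k) * Fintype.card (Inputs S k) <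
      100 * ∑ i : Bool × Bool × Option (Bool × Fin n), outcomeCount S k s
        {ω | Unaccountable S Φs Φl fs fa T (framingAdversary S Φs Φl σ i.1 i.2.1 i.2.2) k ω h} := by
  by_contra! hcon
  let X := {u // σ u = true} → Fin (S.m.eval k) → Bool
  let Y := {u // ¬ σ u = true} → Fin (S.m.eval k) → Bool
  let g : X × Y → Inputs S k := (glue S σ k).symm
  let bad : Finset (Inputs S k × Inputs S k) := Finset.univ.filter fun p =>
    ∃ i : Bool × Bool × Option (Bool × Fin n), Unaccountable S Φs Φl fs fa T
      (framingAdversary S Φs Φl σ i.1 i.2.1 i.2.2) k (outcomeOf S k s p.1 p.2) h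
  have hgood : ∀ z w, (z, w) ∉ bad → ∀ c mix e, ¬ Unaccountable S Φs Φl fs fa T
      (framingAdversary S Φs Φl σ c mix e) k (outcomeOf S k s z w) h := by
    intro z w hzw c mix e hu
    exact hzw (Finset.mem_filter.2 ⟨Finset.mem_univ _, (c, mix, e), hu⟩)
  have hΓ : Fintype.card (Inputs S k) = Fintype.card X * Fintype.card Y := by
    rw [Fintype.card_congr (glue S σ k), Fintype.card_prod]
  have hbad : 100 * bad.card ≤
      (Fintype.card X * Fintype.card Y) * (Fintype.card X * Fintype.card Y) := by
    rw [← hΓ]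
    refine le_trans (Nat.mul_le_mul_left 100 ?_) hcon
    refine le_trans (Finset.card_le_card ?_) Finset.card_biUnion_le
    intro p hp
    obtain ⟨i, hi⟩ := (Finset.mem_filter.1 hp).2
    exact Finset.mem_biUnion.2 ⟨i, Finset.mem_univ _, Finset.mem_filter.2 ⟨Finset.mem_univ _, hi⟩⟩
  have ginj : Function.Injective g := (glue S σ k).symm.injective
  have hlim := hbits (fun _ _ => Data.nil) 0
  -- Lengths are nonnegative, so the data limit itself gives `m ⌊n/2⌋ > 1`, hence `|X| ≥ 4`.
  have hM2 : 2 ≤ S.m.eval k * (n / 2) := by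
    have : (0 : ℤ) ≤ (((S.service k).encode
      ((S.service k).record (fun _ _ => Data.nil) 0)).length : ℤ) := Int.natCast_nonneg _
    have h2 : (1 : ℤ) < ((S.m.eval k * (n / 2) : ℕ) : ℤ) := by push_cast at hlim ⊢; linarith
    exact_mod_cast h2
  have hcardX : Fintype.card X = 2 ^ (S.m.eval k * (n / 2)) := by
    simp only [X, Fintype.card_fun, Fintype.card_bool, Fintype.card_fin, hσ, pow_mul]
  have hcardY : Fintype.card Y = 2 ^ (S.m.eval k * (n - n / 2)) := by
    simp only [Y, Fintype.card_fun, Fintype.card_bool, Fintype.card_fin, pow_mul]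
    rw [Fintype.card_subtype_compl, hσ, Fintype.card_fin]
  have hXpos : 0 < Fintype.card X := by rw [hcardX]; positivity
  have hYpos : 0 < Fintype.card Y := by rw [hcardY]; positivity
  let ρ : X → Y → Record n := fun x y => splitRecord S σ k s (bits (g (x, y))) h
  let x₀ : X := fun _ _ => false
  let y₀ : Y := fun _ _ => false
  -- Decodability of `y`: the chain of a client that hears only the first side contains it. By
  -- `side_true` this chain does not depend on the second side's inputs, so the dummy `y₀` is
  -- harmless.
  let C₁ : X → Record n → Y → Prop := fun x R y => ∀ v (hv : ¬ σ v = true),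
    inputTx v (List.ofFn (y ⟨v, hv⟩)) ∈
      txsOf (sideChain S σ k s (bits (g (x, y₀))) R r₀ true).toList
  let C₂ : Y → Record n → X → Prop := fun y R x => ∀ v (hv : σ v = true),
    inputTx v (List.ofFn (x ⟨v, hv⟩)) ∈
      txsOf (sideChain S σ k s (bits (g (x₀, y))) R r₀ false).toList
  have side_true : ∀ x y R, sideChain S σ k s (bits (g (x, y))) R r₀ true =
      sideChain S σ k s (bits (g (x, y₀))) R r₀ true := fun x y R =>
    sideChain_congr (fun u hu => by
      simp only [bits, g, glue_symm_of_true hu]) R r₀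
  have side_false : ∀ x y R, sideChain S σ k s (bits (g (x, y))) R r₀ false =
      sideChain S σ k s (bits (g (x₀, y))) R r₀ false := fun x y R =>
    sideChain_congr (fun u hu => by
      simp only [bits, g, glue_symm_of_false (Bool.eq_false_iff.1 hu)]) R r₀
  have bits_true : ∀ (x : X) (y : Y) v (hv : σ v = true),
      bits (g (x, y)) v = List.ofFn (x ⟨v, hv⟩) := fun x y v hv => by
    simp only [bits, g, glue_symm_of_true hv]
  have bits_false : ∀ (x : X) (y : Y) v (hv : ¬ σ v = true),
      bits (g (x, y)) v = List.ofFn (y ⟨v, hv⟩) := fun x y v hv => by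
    simp only [bits, g, glue_symm_of_false hv]
  refine false_of_card_image_le ρ C₁ C₂ ?_ ?_
    -- A tuple is exceptional only if every completion by the coordinates not used is bad. Each one
    -- then accounts for a whole fibre of `bad`, so the proportion of exceptional tuples is at most
    -- that of `bad`.
    (Finset.univ.filter fun p : X × Y => ∀ w, (g p, w) ∈ bad)
    (Finset.univ.filter fun p : X × Y × Y => ∀ x' : X, (g (p.1, p.2.1), g (x', p.2.2)) ∈ bad)
    (Finset.univ.filter fun p : X × Y × X => ∀ y' : Y, (g (p.1, p.2.1), g (p.2.2, y')) ∈ bad)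
    ?_ ?_ ?_ ?_ ?_ ?_ ?_ ?_
  · intro x R y y' h1 h2
    funext v
    exact ofFn_eq_of_mem_chain hvalid (h1 v v.2) (h2 v v.2)
  · intro y R x x' h1 h2
    funext v
    exact ofFn_eq_of_mem_chain hvalid (h1 v v.2) (h2 v v.2)
  -- Here the submitted inputs are the true ones. If both side chains are prefixes of the joint
  -- chain, they are comparable and the longer one has all inputs; otherwise some side chain extends
  -- the joint chain.
  · intro x y hxy
    simp only [Finset.mem_filter, Finset.mem_univ, true_and, not_forall] at hxy
    obtain ⟨w, hw⟩ := hxy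
    have e : ∀ c, recordInputs S σ c false (g (x, y)) w = g (x, y) := by
      intro c; funext u; simp [recordInputs]
    have hc := consistent_of_accountable (σ := σ) (mix := false) (w := w) (w' := w) hfs hfa hs hT
      hds hdl (by rw [e, e]) (hgood _ _ hw false false) (hgood _ _ hw true false)
    rw [e] at hc
    have hjoint : ∀ b, (jointChain S σ k s (bits (g (x, y))) (ρ x y) r₀).toList <+:
        (sideChain S σ k s (bits (g (x, y))) (ρ x y) r₀ b).toList →
        ∀ v, inputTx v (bits (g (x, y)) v) ∈
          txsOf (sideChain S σ k s (bits (g (x, y))) (ρ x y) r₀ b).toList :=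
      fun b hb v => txsOf_mono hb (hc.joint v)
    have left : (∀ v, inputTx v (bits (g (x, y)) v) ∈
        txsOf (sideChain S σ k s (bits (g (x, y))) (ρ x y) r₀ true).toList) →
        C₁ x (ρ x y) y := by
      intro hall v hv
      rw [← bits_false x y v hv, ← side_true x y]
      exact hall v
    have right : (∀ v, inputTx v (bits (g (x, y)) v) ∈
        txsOf (sideChain S σ k s (bits (g (x, y))) (ρ x y) r₀ false).toList) →
        C₂ y (ρ x y) x := by
      intro hall v hv
      rw [← bits_true x y v hv, ← side_false x y]
      exact hall v
    rcases hc.comparable true with h1 | h1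
    · rcases hc.comparable false with h2 | h2
      · rcases List.prefix_or_prefix_of_prefix h1 h2 with h3 | h3
        · refine Or.inr (right fun v => ?_)
          have := hc.side v
          cases hv : σ v
          · rwa [hv] at this
          · rw [hv] at this
            exact txsOf_mono h3 this
        · refine Or.inl (left fun v => ?_)
          have := hc.side v
          cases hv : σ v
          · rw [hv] at this
            exact txsOf_mono h3 this
          · rwa [hv] at this
      · exact Or.inr (right (hjoint false h2))
    · exact Or.inl (left (hjoint true h1))
  -- Here the true inputs are `(x, y)`, but the second side submits as with `y'` in one world, and
  -- the first side as with `x'` in the other. The values `x''` and `y''` belong to coins that stay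
  -- unused. The first side's chain contains `y'` and the joint chain `y`; they are comparable.
  · intro x y x' y' h1 h2 hR hC
    simp only [Finset.mem_filter, Finset.mem_univ, true_and, not_forall] at h1 h2
    obtain ⟨x'', h1⟩ := h1
    obtain ⟨y'', h2⟩ := h2
    have e1 : recordInputs S σ false true (g (x, y)) (g (x'', y')) = g (x, y') := by
      funext u
      by_cases hu : σ u = true
      · simp [recordInputs, g, glue_symm_of_true hu, hu]
      · have hu' : σ u = false := by simpa using hu
        simp only [recordInputs, hu', and_self, if_true, g, glue_symm_of_false hu]
    have e2 : recordInputs S σ true true (g (x, y)) (g (x', y'')) = g (x', y) := by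
      funext u
      by_cases hu : σ u = true
      · simp only [recordInputs, hu, and_self, if_true, g, glue_symm_of_true hu]
      · simp [recordInputs, g, glue_symm_of_false hu, hu]
    have hc := consistent_of_accountable (σ := σ) (mix := true) (w := g (x'', y'))
      (w' := g (x', y'')) hfs hfa hs hT hds hdl (by rw [e1, e2]; exact hR)
      (hgood _ _ h1 false true) (hgood _ _ h2 true true)
    rw [e1] at hc
    funext v
    have k1 := hC v v.2
    rw [← side_true x y] at k1
    have k2 := hc.joint v
    rw [bits_false x y v v.2] at k2
    rcases hc.comparable true with h3 | h3
    · exact ofFn_eq_of_mem_chain hvalid (txsOf_mono h3 k1) k2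
    · exact ofFn_eq_of_mem_chain hvalid k1 (txsOf_mono h3 k2)
  -- The `-1` in the data limit gives the factor `2`: at most `2 ^ (m ⌊n/2⌋ - 1) = |X| / 2` records
  -- occur.
  · have hle := card_le_two_pow_of_injOn
      (Finset.univ.image fun p : X × Y => ρ p.1 p.2) (S.service k).encode
      (S.m.eval k * (n / 2) - 1) ?_ ?_
    · rw [hcardX, ← Nat.sub_add_cancel (show 1 ≤ S.m.eval k * (n / 2) by omega), pow_succ,
        mul_comm]
      refine Nat.mul_le_mul_right 2 (le_trans (le_of_eq ?_) hle)
      congr!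
    · refine (S.service k).encode_injOn.mono ?_
      intro R hR
      obtain ⟨p, -, rfl⟩ := Finset.mem_image.1 hR
      exact ⟨_, h, (splitRecord_eq_record S σ k s (bits (g (p.1, p.2))) h).symm⟩
    · intro R hR
      obtain ⟨p, -, rfl⟩ := Finset.mem_image.1 hR
      have := hbits (fun r u => splitSubs S σ k s (bits (g (p.1, p.2)))
        (splitRecord S σ k s (bits (g (p.1, p.2))) r) r u) h
      rw [← splitRecord_eq_record] at this
      zify [show 1 ≤ S.m.eval k * (n / 2) by omega]
      exact_mod_cast this
  · rw [hcardX]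
    calc 3 ≤ 2 ^ 2 := by norm_num
      _ ≤ _ := Nat.pow_le_pow_right (by norm_num) hM2
  · rw [hcardX, hcardY]
    -- For even `n` the sides have equal size; for odd `n` the second has one more validator, so
    -- `|Y| = 2 ^ m * |X|` with `m ≥ 1`.
    rcases Nat.even_or_odd' n with ⟨j, hj | hj⟩
    · left
      congr 2
      omega
    · right
      have hm : 1 ≤ S.m.eval k := Nat.pos_of_ne_zero fun h0 => by simp [h0] at hM2
      rw [← pow_succ']
      refine Nat.pow_le_pow_right (by norm_num) ?_
      rw [show n - n / 2 = n / 2 + 1 by omega, mul_add]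
      omega
  · have hle : (Finset.univ.filter fun p : X × Y => ∀ w, (g p, w) ∈ bad).card *
        Fintype.card (Inputs S k) ≤ bad.card := by
      rw [← Finset.card_univ, ← Finset.card_product]
      refine Finset.card_le_card_of_injOn (fun q => (g q.1, q.2)) ?_ ?_
      · rintro ⟨p, w⟩ hp
        simp only [Finset.coe_product, Set.mem_prod, Finset.mem_coe, Finset.mem_filter,
          Finset.mem_univ, true_and] at hp
        exact hp.1 w
      · rintro ⟨p, w⟩ _ ⟨p', w'⟩ _ e
        simp only [Prod.mk.injEq] at e
        rw [ginj e.1, e.2]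
    rw [hΓ] at hle
    refine Nat.le_of_mul_le_mul_right ?_ (Nat.mul_pos hXpos hYpos)
    refine le_trans ?_ hbad
    rw [mul_assoc]
    exact Nat.mul_le_mul_left 100 hle
  · have hle : (Finset.univ.filter fun p : X × Y × Y =>
        ∀ x' : X, (g (p.1, p.2.1), g (x', p.2.2)) ∈ bad).card * Fintype.card X ≤ bad.card := by
      rw [← Finset.card_univ (α := X), ← Finset.card_product]
      refine Finset.card_le_card_of_injOn
        (fun q => (g (q.1.1, q.1.2.1), g (q.2, q.1.2.2))) ?_ ?_
      · rintro ⟨p, w⟩ hp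
        simp only [Finset.coe_product, Set.mem_prod, Finset.mem_coe, Finset.mem_filter,
          Finset.mem_univ, true_and] at hp
        exact hp.1 w
      · rintro ⟨⟨x, y, y'⟩, w⟩ _ ⟨⟨x₁, y₁, y₁'⟩, w₁⟩ _ e
        simp only [Prod.mk.injEq] at e
        obtain ⟨e1, e2⟩ := e
        have e1 := ginj e1
        have e2 := ginj e2
        simp only [Prod.mk.injEq] at e1 e2 ⊢
        exact ⟨⟨e1.1, e1.2, e2.2⟩, e2.1⟩
    refine Nat.le_of_mul_le_mul_right ?_ hXpos
    refine le_trans ?_ (hbad.trans_eq (by ring))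
    rw [mul_assoc]
    exact Nat.mul_le_mul_left 100 hle
  · have hle : (Finset.univ.filter fun p : X × Y × X =>
        ∀ y' : Y, (g (p.1, p.2.1), g (p.2.2, y')) ∈ bad).card * Fintype.card Y ≤ bad.card := by
      rw [← Finset.card_univ (α := Y), ← Finset.card_product]
      refine Finset.card_le_card_of_injOn
        (fun q => (g (q.1.1, q.1.2.1), g (q.1.2.2, q.2))) ?_ ?_
      · rintro ⟨p, w⟩ hp
        simp only [Finset.coe_product, Set.mem_prod, Finset.mem_coe, Finset.mem_filter,
          Finset.mem_univ, true_and] at hp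
        exact hp.1 w
      · rintro ⟨⟨x, y, y'⟩, w⟩ _ ⟨⟨x₁, y₁, y₁'⟩, w₁⟩ _ e
        simp only [Prod.mk.injEq] at e
        obtain ⟨e1, e2⟩ := e
        have e1 := ginj e1
        have e2 := ginj e2
        simp only [Prod.mk.injEq] at e1 e2 ⊢
        exact ⟨⟨e1.1, e1.2, e2.1⟩, e2.2⟩
    refine Nat.le_of_mul_le_mul_right ?_ hYpos
    refine le_trans ?_ (hbad.trans_eq (by ring))
    rw [mul_assoc]
    exact Nat.mul_le_mul_left 100 hle

/-! ### Limits and a union bound -/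

lemma Negligible.tendsto {f : ℕ → ℝ} (hf : Negligible f) :
    Filter.Tendsto f Filter.atTop (nhds 0) := by
  simpa using hf 0

lemma System.prob_union_le (S : System n) (Z : Environment) (A : Adversary n) (k : ℕ)
    (E E' : Set (Outcome n)) : S.prob Z A k (E ∪ E') ≤ S.prob Z A k E + S.prob Z A k E' := by
  have hfin : ∀ E, (S.outcome Z A k).toOuterMeasure E ≠ ⊤ := by
    intro E
    refine ne_top_of_le_ne_top ENNReal.one_ne_top ?_
    refine (MeasureTheory.measure_mono (Set.subset_univ _)).trans_eq ?_
    exact (PMF.toOuterMeasure_apply_eq_one_iff _ _).2 (Set.subset_univ _)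
  unfold System.prob
  rw [← ENNReal.toReal_add (hfin E) (hfin E')]
  exact ENNReal.toReal_mono (ENNReal.add_ne_top.2 ⟨hfin E, hfin E'⟩)
    (MeasureTheory.measure_union_le E E')

end Main

end Consensus

open Consensus in
theorem theorem7 {n : ℕ} (S : Consensus.System n) (hvalid : S.InputsValid)
    (hbits : S.DataLimited) (F : ℕ) (hF : n ≤ 2 * F)
    (hsafe : ∃ fs : ℕ, 0 < fs ∧ S.AccountableSafety F fs)
    (T : ℕ → ℕ) (hT : ∃ q : Polynomial ℕ, ∀ k, T k ≤ q.eval k)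
    (fa : ℕ) (hfa : 0 < fa) :
    ¬ S.AccountableLiveness F fa T := by
  rintro ⟨Φl, hlive⟩
  obtain ⟨fs, hfs, Φs, hsafe⟩ := hsafe
  obtain ⟨q, hq⟩ := hT
  -- The sides have sizes `⌊n/2⌋` and `⌈n/2⌉`, both at most `F` because `n ≤ 2 * F`.
  let σ : Fin n → Bool := fun u => decide (u.val < n / 2)
  have hσ : Fintype.card {u // σ u = true} = n / 2 := by
    simp only [σ, decide_eq_true_eq, Fintype.card_subtype]
    rw [Fin.card_filter_val_lt]
    omega
  have hcard : ∀ c, (Finset.univ.filter fun u => σ u = c).card ≤ F := by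
    rw [Fintype.card_subtype] at hσ
    have hsum := Finset.card_filter_add_card_filter_not (s := (Finset.univ : Finset (Fin n)))
      (fun u => σ u = true)
    rw [Finset.card_univ, Fintype.card_fin] at hsum
    intro c
    cases c
    · simp only [Bool.not_eq_true] at hsum
      omega
    · omega
  -- The chains are inspected in slot `q(k) ≥ T k`; the horizon leaves time for both forensic
  -- protocols to deliver their proofs afterwards.
  let h : Polynomial ℕ := q + Φs.delay + Φl.delay
  let Z := uniformEnvironment S
  let A : Bool × Bool × Option (Bool × Fin n) → Adversary n :=
    fun i => framingAdversary S Φs Φl σ i.1 i.2.1 i.2.2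
  -- The number of adversaries does not depend on `k`, so the total failure probability tends to
  -- `0`; a single `k` with total below `1/100` suffices.
  have hlim : Filter.Tendsto (fun k => ∑ i, S.prob Z (A i) k
      {ω | Unaccountable S Φs Φl fs fa (T k) (A i) k ω (h.eval k)}) Filter.atTop (nhds 0) := by
    rw [← Finset.sum_const_zero (s := (Finset.univ :
      Finset (Bool × Bool × Option (Bool × Fin n))))]
    refine tendsto_finsetSum _ fun i _ => ?_
    have h1 := (hsafe Z (A i) (hcard i.1) h).tendsto
    have h2 := (hlive Z (A i) (hcard i.1) h).tendsto
    have h3 := h1.add h2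
    rw [add_zero] at h3
    exact squeeze_zero (fun k => ENNReal.toReal_nonneg)
      (fun k => System.prob_union_le S Z (A i) k _ _) h3
  obtain ⟨k, hk1, hk2⟩ := ((hlim.eventually_lt_const
    (show (0 : ℝ) < 1 / 100 by norm_num)).and hbits).exists
  obtain ⟨s, hs, hle⟩ := exists_setup_of_prob_lt S A (fun _ => rfl) k _ hk1
  have hlt := card_inputs_lt_outcomeCount (S := S) (σ := σ) (Φs := Φs) (Φl := Φl)
    (r₀ := q.eval k) (h := h.eval k) hvalid hfs hfa hs (hq k)
    (by simp only [h, Polynomial.eval_add]; omega)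
    (by simp only [h, Polynomial.eval_add]; omega) hk2 hσ
  exact absurd hle (not_le.2 hlt)
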